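/- Let $d\in\{3,4\}$, let $H$ be a Hermitian $d\times d$ matrix and let $\beta\ge 0$ be real. Write $\tau(\beta)=e^{-\beta H}/\operatorname{Tr}e^{-\beta H}$. (A) Let $H=\sum_{i=0}^{d-1}E_i|i\rangle\langle i|$ with an orthonormal basis $(|i\rangle)$ and $E_0\le E_1\le\dots\le E_{d-1}$. Let $p(\beta)=(p_i(\beta))_{i}$ with $p_i(\beta)=e^{-\beta E_i}/\sum_j e^{-\beta E_j}$, and $p_i=p_i(\beta)$. With indices modulo $d$, put $r_n=\sum_j p_jp_{j+n}\,e_j$, $q=r_0$, and let $\Pi$ be the cyclic permutation matrix $\Pi_{ij}=\delta_{i,\,j+1 \bmod d}$. Let $\mathcal P$ be the polytope in $\mathbb R^d$ that is the convex hull of all points $$P_0\,q+\sum_{n=1}^{\lfloor d/2\rfloor}\bigl(\lfloor 2n/d\rfloor+1\bigr)^{-1}(\mathbb 1+\Pi^n)\,P_n\,r_n ,$$ where $P_0,\dots,P_{\lfloor d/2\rfloor}$ run over all $d\times d$ permutation matrices. Use the linear coordinates $x_n(p)=(n+1)p_{n+1}-\sum_{i=0}^{n}p_i$ for $0\le n\le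 d-2$ and $x_{d-1}(p)=-\sum_i p_i$ on $\mathbb R^d$, write $x_n=x_n(p(\beta))$ (so $x_{d-1}=-1$), and let $v_i$ $(0\le i\le d-1)$ be the point with coordinates $(0,\dots,0,x_i,x_{i+1},\dots,x_{d-2},-1)$ (first $i$ coordinates zero). Call a unitary on $\mathbb C^d\otimes\mathbb C^d$ block-diagonal if it leaves invariant each of the locally classical subspaces $\operatorname{span}\{|j\rangle\otimes|j+i\rangle : 0\le j\le d-1\}$, $0\le i\le d-1$ (indices modulo $d$). Then: 1. the convex hull of $v_0,\dots,v_{d-1}$ is contained in $\mathcal P$; 2. every $v\in\mathcal P$ is a symmetric marginal vector reachable by a block-diagonal unitary: there is a block-diagonal unitary $U$ such that both marginals of $U(\tau(\beta)\otimes\tau(\beta))U^\dagger$ equal $\sum_i v_i|i\rangle\langle i|$; 3. for every $\beta'$ with $0\le\beta'\le\beta$, the thermal vector $p(\beta')$ lies in the convex hull of $v_0,\dots,v_{d-1}$, hence in $\mathcal P$, and there is a block-diagonal unitary $U$ such that both marginals of $U(\tau(\beta)\otimes\tau(\beta))U^\dagger$ equal $\tau(\beta')$. (B) Consequently, symmetrically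 thermalizing unitaries exist for all symmetric two-qutrit and two-ququart systems: for every $\beta'$ with $0\le\beta'\le\beta$ there is a unitary $U$ on $\mathbb C^d\otimes\mathbb C^d$ with $$\operatorname{Tr}_B\bigl(U(\tau(\beta)\otimes\tau(\beta))U^\dagger\bigr)=\operatorname{Tr}_A\bigl(U(\tau(\beta)\otimes\tau(\beta))U^\dagger\bigr)=\tau(\beta').$$ -/

import Mathlib

open scoped Matrix Kronecker

noncomputable section

/-! ### Thermal states, partial traces, symmetrically thermalizing unitaries -/

/-- The thermal (Gibbs) state `exp (-β H) / Tr (exp (-β H))` of the Hamiltonian `H`. -/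
def gibbsState {d : ℕ} (H : Matrix (Fin d) (Fin d) ℂ) (β : ℝ) : Matrix (Fin d) (Fin d) ℂ :=
  (NormedSpace.exp (-(β : ℂ) • H)).trace⁻¹ • NormedSpace.exp (-(β : ℂ) • H)

/-- Partial trace over the second factor `B`: the reduced state of `A`. -/
def partialTraceB {d : ℕ} (ρ : Matrix (Fin d × Fin d) (Fin d × Fin d) ℂ) :
    Matrix (Fin d) (Fin d) ℂ :=
  Matrix.of fun i j => ∑ k, ρ (i, k) (j, k)

/-- Partial trace over the first factor `A`: the reduced state of `B`. -/
def partialTraceA {d : ℕ} (ρ : Matrix (Fin d × Fin d) (Fin d × Fin d) ℂ) :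
    Matrix (Fin d) (Fin d) ℂ :=
  Matrix.of fun i j => ∑ k, ρ (k, i) (k, j)

/-- The joint state `U (τ(β) ⊗ τ(β)) U†` of two copies of the system after the unitary `U`. -/
def evolvedState {d : ℕ} (H : Matrix (Fin d) (Fin d) ℂ) (β : ℝ)
    (U : Matrix (Fin d × Fin d) (Fin d × Fin d) ℂ) :
    Matrix (Fin d × Fin d) (Fin d × Fin d) ℂ :=
  U * (gibbsState H β ⊗ₖ gibbsState H β) * Uᴴ

/-- `U` is unitary and turns `τ(β) ⊗ τ(β)` into a state both of whose marginals are `σ`. -/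
def HasSymmetricMarginals {d : ℕ} (H : Matrix (Fin d) (Fin d) ℂ) (β : ℝ)
    (U : Matrix (Fin d × Fin d) (Fin d × Fin d) ℂ) (σ : Matrix (Fin d) (Fin d) ℂ) : Prop :=
  U ∈ Matrix.unitaryGroup (Fin d × Fin d) ℂ ∧
    partialTraceB (evolvedState H β U) = σ ∧ partialTraceA (evolvedState H β U) = σ

/-- `U` is a symmetrically thermalizing unitary (STU) for two copies of the system with
Hamiltonian `H`, from inverse temperature `β` to inverse temperature `β'`. -/
def IsSTU {d : ℕ} (H : Matrix (Fin d) (Fin d) ℂ) (β β' : ℝ)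
    (U : Matrix (Fin d × Fin d) (Fin d × Fin d) ℂ) : Prop :=
  HasSymmetricMarginals H β U (gibbsState H β')

/-! ### Locally classical subspaces -/

/-- The locally classical subspace `span {|j⟩ ⊗ |j+i⟩ : j}`, indices modulo `d`, where `|j⟩` is the
`j`-th column of `V`. The index `i = 0` gives `H_q`, the index `i ≠ 0` gives `H_{r_i}`. -/
def locallyClassicalSubspace {d : ℕ} (V : Matrix (Fin d) (Fin d) ℂ) (i : Fin d) :
    Submodule ℂ (Fin d × Fin d → ℂ) :=
  Submodule.span ℂ (Set.range fun (j : Fin d) (x : Fin d × Fin d) => V x.1 j * V x.2 (j + i))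

/-- `U` is block-diagonal for the decomposition of the joint space into the locally classical
subspaces: it maps each of them into itself. -/
def IsLCSBlockDiagonal {d : ℕ} (V : Matrix (Fin d) (Fin d) ℂ)
    (U : Matrix (Fin d × Fin d) (Fin d × Fin d) ℂ) : Prop :=
  ∀ i, ∀ x ∈ locallyClassicalSubspace V i, U *ᵥ x ∈ locallyClassicalSubspace V i

/-! ### The polytope of symmetric marginals -/

/-- The vector `p(β)` of thermal populations of the energy levels `E`. -/
def thermalVector {d : ℕ} (E : Fin d → ℝ) (β : ℝ) : Fin d → ℝ :=
  fun i => Real.exp (-β * E i) / ∑ j, Real.exp (-β * E j)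

/-- The vector `r_n = ∑ j, p_j p_{j+n} e_j`, indices modulo `d`; `r_0` is `q`. -/
def lcsVector {d : ℕ} [NeZero d] (p : Fin d → ℝ) (n : ℕ) : Fin d → ℝ :=
  fun j => p j * p (j + Fin.ofNat d n)

/-- The cyclic permutation matrix `Π` with entries `Π_{ij} = δ_{i, j+1 mod d}`. -/
def cyclicMatrix (d : ℕ) [NeZero d] : Matrix (Fin d) (Fin d) ℝ :=
  Matrix.of fun i j => if i = j + Fin.ofNat d 1 then 1 else 0

/-- The point
`P_{σ 0} q + ∑_{n=1}^{k} (⌊2n/d⌋ + 1)⁻¹ (1 + Π^n) P_{σ n} r_n`, with `k = ⌊d/2⌋`,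
for a choice of `k + 1` permutations (`P_σ` is the permutation matrix of `σ`). -/
def polytopePoint {d : ℕ} [NeZero d] (p : Fin d → ℝ)
    (σ : Fin (d / 2 + 1) → Equiv.Perm (Fin d)) : Fin d → ℝ :=
  (σ 0).permMatrix ℝ *ᵥ lcsVector p 0 +
    ∑ m : Fin (d / 2),
      (((2 * ((m : ℕ) + 1) / d : ℕ) : ℝ) + 1)⁻¹ •
        ((1 + cyclicMatrix d ^ ((m : ℕ) + 1)) *ᵥ
          ((σ m.succ).permMatrix ℝ *ᵥ lcsVector p ((m : ℕ) + 1)))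

/-- The polytope of symmetric marginal vectors: the convex hull of the `(d!)^(k+1)` points above. -/
def marginalPolytope {d : ℕ} [NeZero d] (p : Fin d → ℝ) : Set (Fin d → ℝ) :=
  convexHull ℝ (Set.range (polytopePoint p))

/-! ### The simplex with vertices `v_0, …, v_{d-1}` -/

/-- The coordinates `x_n = (n+1) p_{n+1} - ∑_{i ≤ n} p_i` for `n ≤ d - 2`, together with
`x_{d-1} = - ∑ i, p_i`. -/
def newCoords {d : ℕ} (p : Fin d → ℝ) : Fin d → ℝ :=
  fun n =>
    if h : (n : ℕ) + 1 < d then ((n : ℕ) + 1 : ℝ) * p ⟨n + 1, h⟩ - ∑ i ∈ Finset.Iic n, p i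
    else -∑ i, p i

/-- The point `v_i = (0, …, 0, x_i, x_{i+1}, …, x_{d-2}, x_{d-1})` in the new coordinates, where
`x_n` are the coordinates of `p` (so the last one is `-1` if `p` is a probability vector):
`v_0` is `p` itself and `v_{d-1} = (0, …, 0, -1)` is the maximally mixed point. -/
def simplexVertex {d : ℕ} (p : Fin d → ℝ) (i : Fin d) : Fin d → ℝ :=
  fun n => if n < i then 0 else newCoords p n

/-- The convex hull of `v_0, …, v_{d-1}`, in the new coordinates. -/
def thermalSimplex {d : ℕ} (p : Fin d → ℝ) : Set (Fin d → ℝ) :=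
  convexHull ℝ (Set.range (simplexVertex p))

end

/-! ### The Schur–Horn theorem for real diagonal matrices -/

/-! In the energy basis `τ(β) ⊗ τ(β)` is block diagonal over the locally classical subspaces, and
its `n`-th block is `diagonal r_n`. Inside a block two distinct basis vectors differ in both
factors, so every block-diagonal evolution has diagonal marginals, which depend only on the
diagonals of the evolved blocks. By Horn's theorem (`isOrthogonalDiagonal_of_mem_permutohedron`)
those diagonals may be chosen freely in the permutohedra of the `r_n`. Exchanging the two factors
swaps the blocks `n` and `d - n`; choosing the diagonals of paired blocks as shifts of each other,
and symmetrizing block 2 when `d = 4`, makes both marginals equal. What is reached contains the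
weighted Minkowski sum of permutohedra that describes the polytope (`mem_marginalPolytope_iff`).

The rest is convex geometry. The vertex `v_i` is `p` with its first `i + 1` populations replaced by
their mean. For `d = 3, 4` each such vector is written explicitly as a point of the Minkowski sum;
for `d = 4` the ordering of the populations supplies the necessary bounds on convex weights.

Finally, `p(β')` lies in the simplex because the ratios `x_n(β') / x_n(β)` are nonnegative and
increase with `n` up to 1; their increments are the barycentric weights. The monotonicity comes from
convexity of the exponential, which controls how ratios of population gaps vary with temperature
(`exp_gap_mul_le`). -/

/-- The permutohedron of `x`: the convex hull of all rearrangements of `x`. -/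
def permutohedron {n : Type*} [Fintype n] [DecidableEq n] (x : n → ℝ) : Set (n → ℝ) :=
  convexHull ℝ (Set.range fun σ : Equiv.Perm n => σ.permMatrix ℝ *ᵥ x)

/-- `y` is the diagonal of `W * diagonal x * Wᵀ` for an orthogonal matrix `W`. -/
def IsOrthogonalDiagonal {n : Type*} [Fintype n] [DecidableEq n] (x y : n → ℝ) : Prop :=
  ∃ W ∈ Matrix.orthogonalGroup n ℝ, ∀ i, ∑ l, W i l ^ 2 * x l = y i

section SchurHorn

variable {n : Type*} [Fintype n] [DecidableEq n]

theorem Matrix.mem_orthogonalGroup_iff_rows {W : Matrix n n ℝ} :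
    W ∈ Matrix.orthogonalGroup n ℝ ↔ ∀ i j, ∑ l, W i l * W j l = if i = j then 1 else 0 := by
  rw [Matrix.mem_orthogonalGroup_iff, ← Matrix.ext_iff]
  simp [Matrix.mul_apply, Matrix.one_apply]

theorem IsOrthogonalDiagonal.refl (x : n → ℝ) : IsOrthogonalDiagonal x x :=
  ⟨1, one_mem _, fun i => by simp [Matrix.one_apply, ite_pow]⟩

theorem IsOrthogonalDiagonal.comp_perm {x y : n → ℝ} (h : IsOrthogonalDiagonal x y)
    (σ : Equiv.Perm n) : IsOrthogonalDiagonal x (y ∘ σ) := by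
  obtain ⟨W, hW, hy⟩ := h
  rw [Matrix.mem_orthogonalGroup_iff_rows] at hW
  refine ⟨W.submatrix σ id, Matrix.mem_orthogonalGroup_iff_rows.2 fun i j => ?_, fun i => ?_⟩
  · simpa using hW (σ i) (σ j)
  · simpa using hy (σ i)

theorem IsOrthogonalDiagonal.of_comp_perm {x y : n → ℝ} {σ : Equiv.Perm n}
    (h : IsOrthogonalDiagonal (x ∘ σ) y) : IsOrthogonalDiagonal x y := by
  obtain ⟨W, hW, hy⟩ := h
  rw [Matrix.mem_orthogonalGroup_iff_rows] at hW
  refine ⟨W.submatrix id σ.symm, Matrix.mem_orthogonalGroup_iff_rows.2 fun i j => ?_, fun i => ?_⟩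
  · rw [← hW i j, ← Equiv.sum_comp σ]
    simp
  · rw [← hy i, ← Equiv.sum_comp σ]
    simp

/-- Rotating in the plane of the `j`-th and the `k`-th coordinate realizes every transfer
between the diagonal entries `y j` and `y k` that does not increase their distance. -/
theorem IsOrthogonalDiagonal.transfer {x y z : n → ℝ} (h : IsOrthogonalDiagonal x y) {j k : n}
    (hjk : j ≠ k) (hj : z j ∈ Set.uIcc (y j) (y k)) (hsum : z j + z k = y j + y k)
    (hz : ∀ i, i ≠ j → i ≠ k → z i = y i) : IsOrthogonalDiagonal x z := by
  obtain ⟨W, hW, hy⟩ := h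
  rw [Matrix.mem_orthogonalGroup_iff_rows] at hW
  set b := ∑ l, W j l * W k l * x l with hb
  -- `f θ` is the `j`-th diagonal entry after rotating rows `j` and `k` by `θ`. It moves
  -- continuously from `y j` to `y k`, so some angle gives `z j`; the `k`-th entry is then fixed by
  -- `hsum`.
  let f : ℝ → ℝ := fun θ => Real.cos θ ^ 2 * y j + Real.sin θ ^ 2 * y k +
    2 * Real.cos θ * Real.sin θ * b
  have hf : Continuous f := by fun_prop
  have h0 : f 0 = y j := by simp [f]
  have h1 : f (Real.pi / 2) = y k := by simp [f]
  obtain ⟨θ, -, hθ⟩ : z j ∈ f '' Set.uIcc 0 (Real.pi / 2) := by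
    apply intermediate_value_uIcc hf.continuousOn
    rwa [h0, h1]
  have hcs := Real.cos_sq_add_sin_sq θ
  simp only [f] at hθ
  generalize Real.cos θ = c at *
  generalize Real.sin θ = s at *
  have hjj : ∑ l, W j l * W j l = 1 := by simpa using hW j j
  have hkk : ∑ l, W k l * W k l = 1 := by simpa using hW k k
  have hjk0 : ∑ l, W j l * W k l = 0 := by simpa [hjk] using hW j k
  -- Weight `w = 1` yields orthonormality of the new rows, `w = x` their diagonal entries.
  have key : ∀ (a b a' b' : ℝ) (w : n → ℝ),
      ∑ l, (a * W j l + b * W k l) * (a' * W j l + b' * W k l) * w l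
      = a * a' * ∑ l, W j l * W j l * w l + (a * b' + b * a') * ∑ l, W j l * W k l * w l +
        b * b' * ∑ l, W k l * W k l * w l := by
    intro a b a' b' w
    simp only [Finset.mul_sum, ← Finset.sum_add_distrib]
    exact Finset.sum_congr rfl fun l _ => by ring
  have key1 : ∀ (a b a' b' : ℝ), ∑ l, (a * W j l + b * W k l) * (a' * W j l + b' * W k l)
      = a * a' + b * b' := by
    intro a b a' b'
    have := key a b a' b' 1
    simpa [hjj, hkk, hjk0] using this
  have key2 : ∀ (a b : ℝ) (i : n), i ≠ j → i ≠ k → ∑ l, (a * W j l + b * W k l) * W i l = 0 := by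
    intro a b i hij hik
    have e1 : ∑ l, W j l * W i l = 0 := by simpa [hij.symm] using hW j i
    have e2 : ∑ l, W k l * W i l = 0 := by simpa [hik.symm] using hW k i
    simp only [add_mul, mul_assoc, Finset.sum_add_distrib, ← Finset.mul_sum, e1, e2]
    simp
  have key3 : ∀ (a b : ℝ) (i : n), i ≠ j → i ≠ k → ∑ l, W i l * (a * W j l + b * W k l) = 0 := by
    intro a b i hij hik
    simpa [mul_comm] using key2 a b i hij hik
  let W' : Matrix n n ℝ := fun i l =>
    if i = j then c * W j l + s * W k l else if i = k then -s * W j l + c * W k l else W i l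
  have hWj : W' j = fun l => c * W j l + s * W k l := by ext; simp [W']
  have hWk : W' k = fun l => -s * W j l + c * W k l := by ext; simp [W', hjk.symm]
  have hWi : ∀ i, i ≠ j → i ≠ k → W' i = W i := fun i h1 h2 => by ext; simp [W', h1, h2]
  refine ⟨W', Matrix.mem_orthogonalGroup_iff_rows.2 fun i i' => ?_, fun i => ?_⟩
  · rcases eq_or_ne i j with rfl | hij
    · rcases eq_or_ne i' i with rfl | hij'
      · rw [hWj, key1, if_pos rfl]; linarith
      rcases eq_or_ne i' k with rfl | hik'
      · rw [hWj, hWk, key1, if_neg hjk]; ring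
      · rw [hWj, hWi i' hij' hik', key2 _ _ _ hij' hik', if_neg hij'.symm]
    rcases eq_or_ne i k with rfl | hik
    · rcases eq_or_ne i' j with rfl | hij'
      · rw [hWj, hWk, key1, if_neg hij]; ring
      rcases eq_or_ne i' i with rfl | hik'
      · rw [hWk, key1, if_pos rfl]; linarith
      · rw [hWk, hWi i' hij' hik', key2 _ _ _ hij' hik', if_neg hik'.symm]
    · rcases eq_or_ne i' j with rfl | hij'
      · rw [hWj, hWi i hij hik, key3 _ _ _ hij hik, if_neg hij]
      rcases eq_or_ne i' k with rfl | hik'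
      · rw [hWk, hWi i hij hik, key3 _ _ _ hij hik, if_neg hik]
      · rw [hWi i hij hik, hWi i' hij' hik', hW]
  · have yj : ∑ l, W j l * W j l * x l = y j := by simpa [sq] using hy j
    have yk : ∑ l, W k l * W k l * x l = y k := by simpa [sq] using hy k
    rcases eq_or_ne i j with rfl | hij
    · simp only [hWj, sq, key, yj, yk, ← hb]
      linarith
    rcases eq_or_ne i k with rfl | hik
    · simp only [hWk, sq, key, yj, yk, ← hb]
      linear_combination -hsum - hθ + (y j + y i) * hcs
    · rw [hWi i hij hik, hy, hz i hij hik]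

end SchurHorn

/-- A vector whose partial sums dominate those of an antitone vector with the same total is
transformed into it by finitely many transfers. -/
theorem isOrthogonalDiagonal_of_partial_sums {d : ℕ} {x₀ y : Fin d → ℝ} (hy : Antitone y)
    (N : ℕ) : ∀ x : Fin d → ℝ, (Finset.univ.filter fun i => x i ≠ y i).card ≤ N →
    IsOrthogonalDiagonal x₀ x → (∀ m, ∑ i ∈ Finset.Iic m, y i ≤ ∑ i ∈ Finset.Iic m, x i) →
    ∑ i, x i = ∑ i, y i → IsOrthogonalDiagonal x₀ y := by
  induction N with
  | zero =>
    intro x hN hx _ _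
    have : x = y := by
      ext i
      by_contra hi
      have : i ∈ Finset.univ.filter fun i => x i ≠ y i := by simpa using hi
      simp_all
    rwa [← this]
  | succ N ih =>
    intro x hN hx hpart hsum
    by_cases hlt : ∃ k, x k < y k
    swap
    · push Not at hlt
      have : y = x := by
        ext i
        exact (Finset.sum_eq_sum_iff_of_le (fun i _ => hlt i)).1 hsum.symm i (Finset.mem_univ i)
      rwa [this]
    -- `k` is the first deficit. Some earlier `j` has a surplus, since otherwise the partial sum up
    -- to `k` would be too small. Moving `δ` from `j` to `k` makes one of the two entries exact, so
    -- the number of wrong entries drops.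
    obtain ⟨k, hk, hkmin⟩ : ∃ k, x k < y k ∧ ∀ i < k, y i ≤ x i := by
      obtain ⟨k, hk⟩ := WellFounded.has_min (wellFounded_lt (α := Fin d)) {k | x k < y k} hlt
      exact ⟨k, hk.1, fun i hi => not_lt.1 fun h => hk.2 i h hi⟩
    obtain ⟨j, hjk, hj⟩ : ∃ j < k, y j < x j := by
      by_contra! hcon
      refine absurd (hpart k) (not_le.2 (Finset.sum_lt_sum (fun i hi => ?_) ⟨k, by simp, hk⟩))
      rcases (Finset.mem_Iic.1 hi).eq_or_lt with rfl | hi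
      · exact hk.le
      · exact hcon i hi
    set δ := min (x j - y j) (y k - x k) with hδ
    have hδ1 : δ ≤ x j - y j := min_le_left _ _
    have hδ2 : δ ≤ y k - x k := min_le_right _ _
    have hδ0 : 0 < δ := lt_min (by linarith) (by linarith)
    have hyjk : y k ≤ y j := hy hjk.le
    let z : Fin d → ℝ := fun i => if i = j then x j - δ else if i = k then x k + δ else x i
    have zj : z j = x j - δ := by simp [z]
    have zk : z k = x k + δ := by simp [z, hjk.ne']
    have zi : ∀ i, i ≠ j → i ≠ k → z i = x i := fun i h1 h2 => by simp [z, h1, h2]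
    have zsum : ∀ s : Finset (Fin d), j ∈ s → k ∈ s → ∑ i ∈ s, z i = ∑ i ∈ s, x i := by
      intro s hjs hks
      have hks' : k ∈ s.erase j := Finset.mem_erase.2 ⟨hjk.ne', hks⟩
      rw [← Finset.add_sum_erase _ _ hjs, ← Finset.add_sum_erase _ x hjs,
        ← Finset.add_sum_erase _ _ hks', ← Finset.add_sum_erase _ x hks', zj, zk,
        Finset.sum_congr rfl fun i hi => zi i (by simp_all) (by simp_all)]
      ring
    refine ih z ?_ (hx.transfer hjk.ne ?_ ?_ zi) (fun m => ?_)
      ((zsum _ (Finset.mem_univ _) (Finset.mem_univ _)).trans hsum)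
    · refine Nat.lt_succ_iff.1 ((Finset.card_lt_card ?_).trans_le hN)
      rw [Finset.ssubset_iff_of_subset]
      · rcases min_choice (x j - y j) (y k - x k) with h | h
        · exact ⟨j, by simp [hj.ne'], by simp [zj, hδ, h]⟩
        · exact ⟨k, by simp [hk.ne], by simp [zk, hδ, h]⟩
      · intro i hi
        rcases eq_or_ne i j with rfl | hij
        · simp [hj.ne']
        rcases eq_or_ne i k with rfl | hik
        · simp [hk.ne]
        · simpa [zi i hij hik] using hi
    -- The transfer does not overshoot: `x k < y k ≤ y j ≤ x j - δ`, where the middle inequality is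
    -- the antitonicity of `y`.
    · rw [zj, Set.uIcc_of_ge (by linarith)]
      constructor <;> linarith
    · rw [zj, zk]; ring
    · by_cases hmk : k ≤ m
      · rw [zsum _ (Finset.mem_Iic.2 (hjk.le.trans hmk)) (Finset.mem_Iic.2 hmk)]
        exact hpart m
      · refine Finset.sum_le_sum fun i hi => ?_
        have hik : i < k := (Finset.mem_Iic.1 hi).trans_lt (not_le.1 hmk)
        rcases eq_or_ne i j with rfl | hij
        · rw [zj]; linarith
        · rw [zi i hij hik.ne]; exact hkmin i hik

/-! ### Permutation invariance of permutohedra, and Horn's theorem -/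

theorem comp_perm_mem_permutohedron {n : Type*} [Fintype n] [DecidableEq n] (x : n → ℝ)
    (σ : Equiv.Perm n) : x ∘ σ ∈ permutohedron x :=
  subset_convexHull _ _ ⟨σ, Matrix.permMatrix_mulVec σ⟩

theorem permutohedron_comp_perm {n : Type*} [Fintype n] [DecidableEq n] (x : n → ℝ)
    (σ : Equiv.Perm n) : permutohedron (x ∘ σ) = permutohedron x := by
  unfold permutohedron
  congr 1
  ext z
  simp only [Set.mem_range, Matrix.permMatrix_mulVec]
  constructor
  · rintro ⟨τ, rfl⟩
    exact ⟨τ.trans σ, rfl⟩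
  · rintro ⟨τ, rfl⟩
    exact ⟨τ.trans σ.symm, by ext; simp⟩

theorem comp_mem_permutohedron {n : Type*} [Fintype n] [DecidableEq n] {x y : n → ℝ}
    (h : y ∈ permutohedron x) (σ : Equiv.Perm n) : y ∘ σ ∈ permutohedron x := by
  have hconv : Convex ℝ ((fun z : n → ℝ => z ∘ σ) ⁻¹' permutohedron x) :=
    (convex_convexHull ℝ _).linear_preimage (LinearMap.funLeft ℝ ℝ σ)
  refine convexHull_min ?_ hconv h
  rintro _ ⟨τ, rfl⟩
  simp only [Set.mem_preimage, Matrix.permMatrix_mulVec]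
  exact comp_perm_mem_permutohedron x (σ.trans τ)

theorem exists_perm_antitone {d : ℕ} (x : Fin d → ℝ) :
    ∃ σ : Equiv.Perm (Fin d), Antitone (x ∘ σ) := by
  refine ⟨Tuple.sort (fun i => -x i), fun i j hij => ?_⟩
  simpa using Tuple.monotone_sort (fun i => -x i) hij

/-- Horn's theorem: every point of the permutohedron of `x` is the diagonal of an orthogonal
conjugate of `diagonal x`. -/
theorem isOrthogonalDiagonal_of_mem_permutohedron {d : ℕ} {x y : Fin d → ℝ}
    (h : y ∈ permutohedron x) : IsOrthogonalDiagonal x y := by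
  obtain ⟨σ, hσ⟩ := exists_perm_antitone x
  obtain ⟨τ, hτ⟩ := exists_perm_antitone y
  suffices hs : IsOrthogonalDiagonal (x ∘ σ) (y ∘ τ) by
    have := (hs.of_comp_perm).comp_perm τ.symm
    rwa [Function.comp_assoc, Equiv.self_comp_symm, Function.comp_id] at this
  have h' : y ∘ τ ∈ permutohedron (x ∘ σ) := by
    rw [permutohedron_comp_perm]
    exact comp_mem_permutohedron h τ
  generalize x ∘ σ = x at *
  generalize y ∘ τ = y at *
  have hsum : ∑ i, y i = ∑ i, x i := by
    have hconv : Convex ℝ {z : Fin d → ℝ | ∑ i, z i = ∑ i, x i} := by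
      intro u hu v hv a b ha hb hab
      simp only [Set.mem_ofPred_eq] at *
      simp [Finset.sum_add_distrib, ← Finset.mul_sum, hu, hv, ← add_mul, hab]
    refine convexHull_min ?_ hconv h'
    rintro _ ⟨τ, rfl⟩
    simp [Matrix.permMatrix_mulVec, Equiv.sum_comp τ x]
  have hpart : ∀ m, ∑ i ∈ Finset.Iic m, y i ≤ ∑ i ∈ Finset.Iic m, x i := by
    intro m
    have hconv : Convex ℝ {z : Fin d → ℝ | ∑ i ∈ Finset.Iic m, z i ≤ ∑ i ∈ Finset.Iic m, x i} := by
      intro u hu v hv a b ha hb hab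
      simp only [Set.mem_ofPred_eq] at *
      simp only [Pi.add_apply, Pi.smul_apply, smul_eq_mul, Finset.sum_add_distrib,
        ← Finset.mul_sum]
      calc _ ≤ a * ∑ i ∈ Finset.Iic m, x i + b * ∑ i ∈ Finset.Iic m, x i := by gcongr
        _ = _ := by rw [← add_mul, hab, one_mul]
    refine convexHull_min ?_ hconv h'
    rintro _ ⟨τ, rfl⟩
    simp only [Set.mem_ofPred_eq, Matrix.permMatrix_mulVec]
    -- A partial sum is a pairing with the indicator of an initial segment; by the rearrangement
    -- inequality the antitone order maximizes it.
    have hmono : Monovary x (fun i => if i ≤ m then (1 : ℝ) else 0) := by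
      intro i j hij
      refine hσ (not_lt.1 fun hlt => hij.not_ge ?_)
      by_cases hj : j ≤ m
      · simp [hj, hlt.le.trans hj]
      · simp only [hj, if_false]
        split_ifs <;> norm_num
    have := hmono.sum_comp_perm_mul_le_sum_mul (σ := τ)
    have hIic : Finset.univ.filter (· ≤ m) = Finset.Iic m := by ext; simp
    simpa [← Finset.sum_filter, hIic] using this
  exact isOrthogonalDiagonal_of_partial_sums hτ _ x le_rfl (.refl x) hpart hsum.symm

/-! ### The polytope of symmetric marginals as a Minkowski sum of permutohedra -/

theorem convex_permutohedron {n : Type*} [Fintype n] [DecidableEq n] (x : n → ℝ) :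
    Convex ℝ (permutohedron x) :=
  convex_convexHull ℝ _

theorem self_mem_permutohedron {n : Type*} [Fintype n] [DecidableEq n] (x : n → ℝ) :
    x ∈ permutohedron x :=
  comp_perm_mem_permutohedron x 1

/-- The constant vector with the mean of `x` lies in the permutohedron of `x`. -/
theorem mean_mem_permutohedron {d : ℕ} [NeZero d] (x : Fin d → ℝ) :
    (fun _ => (∑ i, x i) / d) ∈ permutohedron x := by
  -- The mean vector is the average of the `d` cyclic shifts of `x`.
  have h := (convex_permutohedron x).sum_mem (t := Finset.univ) (w := fun _ : Fin d => (d : ℝ)⁻¹)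
    (z := fun c => x ∘ Equiv.addRight c) (fun _ _ => by positivity)
    (by simp [mul_inv_cancel₀ (NeZero.ne (d : ℝ))])
    (fun c _ => comp_perm_mem_permutohedron x _)
  convert h using 1
  ext i
  have : ∑ c, x (i + c) = ∑ c, x c := Equiv.sum_comp (Equiv.addLeft i) x
  simp [← Finset.mul_sum, this, div_eq_inv_mul]

theorem cyclicMatrix_pow_mulVec {d : ℕ} [NeZero d] (n : ℕ) (y : Fin d → ℝ) :
    cyclicMatrix d ^ n *ᵥ y = fun i => y (i - Fin.ofNat d n) := by
  induction n with
  | zero => ext i; simp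
  | succ n ih =>
    rw [pow_succ', ← Matrix.mulVec_mulVec, ih]
    ext i
    have h1 : Fin.ofNat d (n + 1) = Fin.ofNat d n + Fin.ofNat d 1 := by
      ext; simp [Fin.val_add]
    have h2 : ∀ j : Fin d, i = j + Fin.ofNat d 1 ↔ i - Fin.ofNat d 1 = j := fun j => by
      rw [sub_eq_iff_eq_add]
    simp only [Matrix.mulVec, dotProduct, cyclicMatrix, Matrix.of_apply, h2, ite_mul, one_mul,
      zero_mul, Finset.sum_ite_eq, Finset.mem_univ, if_true, h1]
    congr 1
    abel

/-- The polytope of symmetric marginals is a weighted Minkowski sum of permutohedra. -/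
theorem mem_marginalPolytope_iff {d : ℕ} [NeZero d] {p v : Fin d → ℝ} :
    v ∈ marginalPolytope p ↔ ∃ y : Fin (d / 2 + 1) → Fin d → ℝ,
      (∀ m : Fin (d / 2 + 1), y m ∈ permutohedron (lcsVector p m)) ∧
      v = y 0 + ∑ m : Fin (d / 2), (((2 * ((m : ℕ) + 1) / d : ℕ) : ℝ) + 1)⁻¹ •
        ((1 + cyclicMatrix d ^ ((m : ℕ) + 1)) *ᵥ y m.succ) := by
  let L : (Fin (d / 2 + 1) → Fin d → ℝ) →ₗ[ℝ] (Fin d → ℝ) :=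
    LinearMap.proj 0 + ∑ m : Fin (d / 2), (((2 * ((m : ℕ) + 1) / d : ℕ) : ℝ) + 1)⁻¹ •
        ((1 + cyclicMatrix d ^ ((m : ℕ) + 1)).mulVecLin ∘ₗ
          LinearMap.proj (φ := fun _ : Fin (d / 2 + 1) => Fin d → ℝ) m.succ)
  have hL : ∀ y, L y = y 0 + ∑ m : Fin (d / 2), (((2 * ((m : ℕ) + 1) / d : ℕ) : ℝ) + 1)⁻¹ •
        ((1 + cyclicMatrix d ^ ((m : ℕ) + 1)) *ᵥ y m.succ) := by
    intro y
    simp [L, LinearMap.sum_apply, Matrix.add_mulVec]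
  have hrange : Set.range (polytopePoint p) = L '' Set.univ.pi fun m : Fin (d / 2 + 1) =>
      Set.range fun σ : Equiv.Perm (Fin d) => σ.permMatrix ℝ *ᵥ lcsVector p m := by
    ext z
    constructor
    · rintro ⟨σ, rfl⟩
      exact ⟨fun m => (σ m).permMatrix ℝ *ᵥ lcsVector p m, fun m _ => ⟨σ m, rfl⟩, by
        rw [hL]; simp [polytopePoint]⟩
    · rintro ⟨y, hy, rfl⟩
      choose σ hσ using fun m => hy m (Set.mem_univ m)
      refine ⟨σ, ?_⟩
      obtain rfl : (fun m : Fin (d / 2 + 1) => (σ m).permMatrix ℝ *ᵥ lcsVector p m) = y :=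
        funext hσ
      rw [hL]; simp [polytopePoint]
  -- Convex hulls commute with linear images and with products.
  rw [marginalPolytope, hrange, ← LinearMap.image_convexHull, convexHull_pi]
  simp only [Set.mem_image, Set.mem_pi, Set.mem_univ, true_imp_iff, hL]
  exact ⟨fun ⟨y, hy, h⟩ => ⟨y, hy, h.symm⟩, fun ⟨y, hy, h⟩ => ⟨y, hy, h.symm⟩⟩

/-! ### The Minkowski sum written out for d = 3 and d = 4 -/

theorem mem_marginalPolytope_three_iff {p v : Fin 3 → ℝ} :
    v ∈ marginalPolytope p ↔ ∃ y₀ ∈ permutohedron (lcsVector p 0),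
      ∃ y₁ ∈ permutohedron (lcsVector p 1), v = fun i => y₀ i + (y₁ i + y₁ (i - 1)) := by
  have key : ∀ y : Fin 2 → Fin 3 → ℝ,
      y 0 + ∑ m : Fin 1, (((2 * ((m : ℕ) + 1) / 3 : ℕ) : ℝ) + 1)⁻¹ •
        ((1 + cyclicMatrix 3 ^ ((m : ℕ) + 1)) *ᵥ y m.succ) =
      fun i => y 0 i + (y 1 i + y 1 (i - 1)) := by
    intro y
    ext i
    rw [Fin.sum_univ_one, Matrix.add_mulVec, cyclicMatrix_pow_mulVec]
    simp
    rfl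
  rw [mem_marginalPolytope_iff]
  constructor
  · rintro ⟨y, hy, rfl⟩
    exact ⟨y 0, hy 0, y 1, hy 1, key y⟩
  · rintro ⟨y₀, h₀, y₁, h₁, rfl⟩
    refine ⟨![y₀, y₁], fun m => ?_, (key ![y₀, y₁]).symm⟩
    fin_cases m
    exacts [h₀, h₁]

theorem mem_marginalPolytope_four_iff {p v : Fin 4 → ℝ} :
    v ∈ marginalPolytope p ↔ ∃ y₀ ∈ permutohedron (lcsVector p 0),
      ∃ y₁ ∈ permutohedron (lcsVector p 1), ∃ y₂ ∈ permutohedron (lcsVector p 2),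
        v = fun i => y₀ i + (y₁ i + y₁ (i - 1)) + (y₂ i + y₂ (i - 2)) / 2 := by
  have key : ∀ y : Fin 3 → Fin 4 → ℝ,
      y 0 + ∑ m : Fin 2, (((2 * ((m : ℕ) + 1) / 4 : ℕ) : ℝ) + 1)⁻¹ •
        ((1 + cyclicMatrix 4 ^ ((m : ℕ) + 1)) *ᵥ y m.succ) =
      fun i => y 0 i + (y 1 i + y 1 (i - 1)) + (y 2 i + y 2 (i - 2)) / 2 := by
    intro y
    ext i
    rw [Fin.sum_univ_two, Matrix.add_mulVec, Matrix.add_mulVec, cyclicMatrix_pow_mulVec,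
      cyclicMatrix_pow_mulVec]
    simp only [show Fin.ofNat 4 (((0 : Fin 2) : ℕ) + 1) = 1 from rfl,
      show Fin.ofNat 4 (((1 : Fin 2) : ℕ) + 1) = 2 from rfl]
    simp [show (1 : Fin 2).succ = 2 from rfl]
    ring
  rw [mem_marginalPolytope_iff]
  constructor
  · rintro ⟨y, hy, rfl⟩
    exact ⟨y 0, hy 0, y 1, hy 1, y 2, hy 2, key y⟩
  · rintro ⟨y₀, h₀, y₁, h₁, y₂, h₂, rfl⟩
    refine ⟨![y₀, y₁, y₂], fun m => ?_, (key ![y₀, y₁, y₂]).symm⟩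
    fin_cases m
    exacts [h₀, h₁, h₂]

/-! ### The simplex lies in the polytope -/

/-- Supplies convex weights `D / B`, including the degenerate case `B = 0`. -/
theorem exists_mul_eq_of_le {D B : ℝ} (h0 : 0 ≤ D) (h : D ≤ B) :
    ∃ t : ℝ, 0 ≤ t ∧ t ≤ 1 ∧ t * B = D := by
  rcases (h0.trans h).eq_or_lt with hB | hB
  · exact ⟨0, le_rfl, zero_le_one, by linarith⟩
  · exact ⟨D / B, by positivity, (div_le_one hB).2 h, div_mul_cancel₀ _ hB.ne'⟩

theorem isLinearMap_newCoords (d : ℕ) :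
    IsLinearMap ℝ (newCoords : (Fin d → ℝ) → Fin d → ℝ) where
  map_add p q := by
    ext n
    simp only [newCoords, Pi.add_apply, Finset.sum_add_distrib]
    split_ifs <;> ring
  map_smul c p := by
    ext n
    simp only [newCoords, Pi.smul_apply, smul_eq_mul, ← Finset.mul_sum]
    split_ifs <;> ring

theorem thermalSimplex_subset_of_vertices {d : ℕ} [NeZero d] {p : Fin d → ℝ}
    (h : ∀ i, simplexVertex p i ∈ newCoords '' marginalPolytope p) :
    thermalSimplex p ⊆ newCoords '' marginalPolytope p :=
  convexHull_min (Set.range_subset_iff.2 h)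
    ((convex_convexHull ℝ _).is_linear_image (isLinearMap_newCoords d))

theorem newCoords_three (p : Fin 3 → ℝ) :
    newCoords p = ![p 1 - p 0, 2 * p 2 - p 0 - p 1, -(p 0 + p 1 + p 2)] := by
  have h0 : Finset.Iic (0 : Fin 3) = {0} := rfl
  have h1 : Finset.Iic (1 : Fin 3) = {0, 1} := rfl
  ext i
  fin_cases i
  · simp [newCoords, h0]
  · simp [newCoords, h1]
    norm_num
    ring
  · simp [newCoords, Fin.sum_univ_three]

theorem newCoords_four (p : Fin 4 → ℝ) :
    newCoords p = ![p 1 - p 0, 2 * p 2 - p 0 - p 1, 3 * p 3 - p 0 - p 1 - p 2,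
      -(p 0 + p 1 + p 2 + p 3)] := by
  have h0 : Finset.Iic (0 : Fin 4) = {0} := rfl
  have h1 : Finset.Iic (1 : Fin 4) = {0, 1} := rfl
  have h2 : Finset.Iic (2 : Fin 4) = {0, 1, 2} := rfl
  ext i
  fin_cases i
  · simp [newCoords, h0]
  · simp [newCoords, h1]
    norm_num
    ring
  · simp [newCoords, h2]
    norm_num
    ring
  · simp [newCoords, Fin.sum_univ_four]

theorem lcsVector_three_zero (p : Fin 3 → ℝ) :
    lcsVector p 0 = ![p 0 * p 0, p 1 * p 1, p 2 * p 2] := by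
  ext i; fin_cases i <;> rfl

theorem lcsVector_three_one (p : Fin 3 → ℝ) :
    lcsVector p 1 = ![p 0 * p 1, p 1 * p 2, p 2 * p 0] := by
  ext i; fin_cases i <;> rfl

theorem lcsVector_four_zero (p : Fin 4 → ℝ) :
    lcsVector p 0 = ![p 0 * p 0, p 1 * p 1, p 2 * p 2, p 3 * p 3] := by
  ext i; fin_cases i <;> rfl

theorem lcsVector_four_one (p : Fin 4 → ℝ) :
    lcsVector p 1 = ![p 0 * p 1, p 1 * p 2, p 2 * p 3, p 3 * p 0] := by
  ext i; fin_cases i <;> rfl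

theorem lcsVector_four_two (p : Fin 4 → ℝ) :
    lcsVector p 2 = ![p 0 * p 2, p 1 * p 3, p 2 * p 0, p 3 * p 1] := by
  ext i; fin_cases i <;> rfl

/-- With all permutations trivial the point is the marginal of the untouched product state: `∑ j, p
i * p j = p i`. -/
theorem self_mem_marginalPolytope_three {p : Fin 3 → ℝ} (hp : p 0 + p 1 + p 2 = 1) :
    p ∈ marginalPolytope p := by
  refine mem_marginalPolytope_three_iff.2 ⟨_, self_mem_permutohedron _, _,
    self_mem_permutohedron _, ?_⟩
  rw [lcsVector_three_zero, lcsVector_three_one]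
  ext i
  fin_cases i <;> simp [show (-1 : Fin 3) = 2 from rfl]
  · linear_combination -p 0 * hp
  · linear_combination -p 1 * hp
  · linear_combination -p 2 * hp

theorem mean_pair_mem_marginalPolytope_three {p : Fin 3 → ℝ} (hp : p 0 + p 1 + p 2 = 1) :
    ![(p 0 + p 1) / 2, (p 0 + p 1) / 2, p 2] ∈ marginalPolytope p := by
  refine mem_marginalPolytope_three_iff.2
    ⟨(1 / 2 : ℝ) • lcsVector p 0 + (1 / 2 : ℝ) • (lcsVector p 0 ∘ Equiv.swap 0 1),
      convex_permutohedron _ (self_mem_permutohedron _) (comp_perm_mem_permutohedron _ _)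
        (by norm_num) (by norm_num) (by norm_num),
      -- Averaging the entries `p 1 * p 2` and `p 2 * p 0` of `r_1` symmetrizes levels 0 and 1, and
      -- leaves the marginal of level 2 unchanged.
      (1 / 2 : ℝ) • lcsVector p 1 + (1 / 2 : ℝ) • (lcsVector p 1 ∘ Equiv.swap 1 2),
      convex_permutohedron _ (self_mem_permutohedron _) (comp_perm_mem_permutohedron _ _)
        (by norm_num) (by norm_num) (by norm_num), ?_⟩
  rw [lcsVector_three_zero, lcsVector_three_one]
  ext i
  fin_cases i <;> simp [show (-1 : Fin 3) = 2 from rfl, Equiv.swap_apply_def]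
  · linear_combination -((p 0 + p 1) / 2) * hp
  · linear_combination -((p 0 + p 1) / 2) * hp
  · linear_combination -p 2 * hp

theorem const_mem_marginalPolytope_three {p : Fin 3 → ℝ} (hp : p 0 + p 1 + p 2 = 1) :
    (fun _ => 1 / 3) ∈ marginalPolytope p := by
  refine mem_marginalPolytope_three_iff.2 ⟨_, mean_mem_permutohedron _, _,
    mean_mem_permutohedron _, ?_⟩
  rw [lcsVector_three_zero, lcsVector_three_one]
  ext i
  simp [Fin.sum_univ_three]
  linear_combination -(p 0 + p 1 + p 2 + 1) / 3 * hp

theorem thermalSimplex_subset_three {p : Fin 3 → ℝ} (hp : p 0 + p 1 + p 2 = 1) :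
    thermalSimplex p ⊆ newCoords '' marginalPolytope p := by
  refine thermalSimplex_subset_of_vertices fun i => ?_
  fin_cases i
  · refine ⟨_, self_mem_marginalPolytope_three hp, ?_⟩
    ext n; simp [simplexVertex]
  · refine ⟨_, mean_pair_mem_marginalPolytope_three hp, ?_⟩
    ext n; fin_cases n <;> simp [simplexVertex, newCoords_three]; ring
  · refine ⟨_, const_mem_marginalPolytope_three hp, ?_⟩
    ext n; fin_cases n <;> simp [simplexVertex, newCoords_three] <;> linarith

/-! ### Vertices of the simplex for two ququarts -/

theorem self_mem_marginalPolytope_four {p : Fin 4 → ℝ} (hp : p 0 + p 1 + p 2 + p 3 = 1) :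
    p ∈ marginalPolytope p := by
  refine mem_marginalPolytope_four_iff.2 ⟨_, self_mem_permutohedron _, _,
    self_mem_permutohedron _, _, self_mem_permutohedron _, ?_⟩
  rw [lcsVector_four_zero, lcsVector_four_one, lcsVector_four_two]
  ext i
  fin_cases i <;> simp [show (-1 : Fin 4) = 3 from rfl, show (-2 : Fin 4) = 2 from rfl]
  · linear_combination -p 0 * hp
  · linear_combination -p 1 * hp
  · linear_combination -p 2 * hp
  · linear_combination -p 3 * hp

/-- Mixing the entries 0 and 1 of `q` alone suffices: `(p 0 - p 1) / 2` must not exceed `p 0 ^ 2 - p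
1 ^ 2`, which holds because the two largest populations sum to at least `1 / 2`. -/
theorem mean_pair_mem_marginalPolytope_four {p : Fin 4 → ℝ} (hp : p 0 + p 1 + p 2 + p 3 = 1)
    (h01 : p 1 ≤ p 0) (h12 : p 2 ≤ p 1) (h23 : p 3 ≤ p 2) :
    ![(p 0 + p 1) / 2, (p 0 + p 1) / 2, p 2, p 3] ∈ marginalPolytope p := by
  obtain ⟨t, ht0, ht1, ht⟩ : ∃ t : ℝ, 0 ≤ t ∧ t ≤ 1 ∧
      t * (p 0 * p 0 - p 1 * p 1) = (p 0 - p 1) / 2 :=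
    exists_mul_eq_of_le (by linarith)
      (by nlinarith [mul_nonneg (sub_nonneg.2 h01) (by linarith : 0 ≤ p 0 + p 1 - 1 / 2)])
  refine mem_marginalPolytope_four_iff.2
    ⟨(1 - t) • lcsVector p 0 + t • (lcsVector p 0 ∘ Equiv.swap 0 1),
      convex_permutohedron _ (self_mem_permutohedron _) (comp_perm_mem_permutohedron _ _)
        (by linarith) ht0 (by ring),
      _, self_mem_permutohedron _, _, self_mem_permutohedron _, ?_⟩
  rw [lcsVector_four_zero, lcsVector_four_one, lcsVector_four_two]
  ext i
  fin_cases i <;> simp [show (-1 : Fin 4) = 3 from rfl, show (-2 : Fin 4) = 2 from rfl]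
  · linear_combination -p 0 * hp + ht
  · linear_combination -p 1 * hp - ht
  · linear_combination -p 2 * hp
  · linear_combination -p 3 * hp

/-- Symmetrizing `q` under `0 ↔ 2` and `r_1` under `(0 1)(2 3)` gives levels 0 and 2 the population
`(p 0 + p 2) / 2` and keeps `p 1` and `p 3`. Level 1 is then moved to the mean of the three by
replacing part of `p 1 ^ 2` in `q` with `p 2 ^ 2` if `p 1` lies above that mean, with `p 0 ^ 2` if
below. The weight is at most 1 because the two populations exchanged sum to at least `1 / 3`. -/
theorem mean_triple_mem_marginalPolytope_four {p : Fin 4 → ℝ} (hp : p 0 + p 1 + p 2 + p 3 = 1)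
    (h01 : p 1 ≤ p 0) (h12 : p 2 ≤ p 1) (h23 : p 3 ≤ p 2) (h3 : 0 ≤ p 3) :
    ![(p 0 + p 1 + p 2) / 3, (p 0 + p 1 + p 2) / 3, (p 0 + p 1 + p 2) / 3, p 3] ∈
      marginalPolytope p := by
  have hhalf : ∀ x : Fin 4 → ℝ, ∀ σ τ : Equiv.Perm (Fin 4),
      (fun i => 1 / 2 * x (σ i) + 1 / 2 * x (τ i)) ∈ permutohedron x := fun x σ τ =>
    convex_permutohedron _ (comp_perm_mem_permutohedron _ _) (comp_perm_mem_permutohedron _ _)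
      (by norm_num) (by norm_num) (by norm_num)
  rcases le_total (p 0 + p 2) (2 * p 1) with hD | hD
  · obtain ⟨t, ht0, ht1, ht⟩ : ∃ t : ℝ, 0 ≤ t ∧ t ≤ 1 ∧
        t * (p 1 * p 1 - p 2 * p 2) = (2 * p 1 - p 0 - p 2) / 3 :=
      exists_mul_eq_of_le (by linarith)
        (by nlinarith [mul_nonneg (sub_nonneg.2 h12) (by linarith : 0 ≤ p 1 + p 2 - 1 / 3)])
    refine mem_marginalPolytope_four_iff.2 ⟨_, convex_permutohedron (lcsVector p 0)
      (hhalf _ 1 (Equiv.swap 0 2)) (hhalf _ (Equiv.swap 1 2) (Equiv.swap 0 1 * Equiv.swap 1 2))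
        (sub_nonneg.2 ht1) ht0 (by ring),
      _, hhalf _ 1 (Equiv.swap 0 1 * Equiv.swap 2 3), _, self_mem_permutohedron _, ?_⟩
    rw [lcsVector_four_zero, lcsVector_four_one, lcsVector_four_two]
    ext i
    fin_cases i <;> simp [show (-1 : Fin 4) = 3 from rfl, show (-2 : Fin 4) = 2 from rfl,
      Equiv.swap_apply_def]
    · linear_combination -((p 0 + p 2) / 2) * hp - ht / 2
    · linear_combination -p 1 * hp + ht
    · linear_combination -((p 0 + p 2) / 2) * hp - ht / 2
    · linear_combination -p 3 * hp
  · obtain ⟨t, ht0, ht1, ht⟩ : ∃ t : ℝ, 0 ≤ t ∧ t ≤ 1 ∧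
        t * (p 0 * p 0 - p 1 * p 1) = (p 0 + p 2 - 2 * p 1) / 3 :=
      exists_mul_eq_of_le (by linarith)
        (by nlinarith [mul_nonneg (sub_nonneg.2 h01) (by linarith : 0 ≤ p 0 + p 1 - 1 / 3)])
    refine mem_marginalPolytope_four_iff.2 ⟨_, convex_permutohedron (lcsVector p 0)
      (hhalf _ 1 (Equiv.swap 0 2)) (hhalf _ (Equiv.swap 0 1) (Equiv.swap 1 2 * Equiv.swap 0 1))
        (sub_nonneg.2 ht1) ht0 (by ring),
      _, hhalf _ 1 (Equiv.swap 0 1 * Equiv.swap 2 3), _, self_mem_permutohedron _, ?_⟩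
    rw [lcsVector_four_zero, lcsVector_four_one, lcsVector_four_two]
    ext i
    fin_cases i <;> simp [show (-1 : Fin 4) = 3 from rfl, show (-2 : Fin 4) = 2 from rfl,
      Equiv.swap_apply_def]
    · linear_combination -((p 0 + p 2) / 2) * hp + ht / 2
    · linear_combination -p 1 * hp - ht
    · linear_combination -((p 0 + p 2) / 2) * hp + ht / 2
    · linear_combination -p 3 * hp

theorem const_mem_marginalPolytope_four {p : Fin 4 → ℝ} (hp : p 0 + p 1 + p 2 + p 3 = 1) :
    (fun _ => 1 / 4) ∈ marginalPolytope p := by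
  refine mem_marginalPolytope_four_iff.2 ⟨_, mean_mem_permutohedron _, _,
    mean_mem_permutohedron _, _, mean_mem_permutohedron _, ?_⟩
  rw [lcsVector_four_zero, lcsVector_four_one, lcsVector_four_two]
  ext i
  simp [Fin.sum_univ_four]
  linear_combination -(p 0 + p 1 + p 2 + p 3 + 1) / 4 * hp

theorem thermalSimplex_subset_four {p : Fin 4 → ℝ} (hp : p 0 + p 1 + p 2 + p 3 = 1)
    (h01 : p 1 ≤ p 0) (h12 : p 2 ≤ p 1) (h23 : p 3 ≤ p 2) (h3 : 0 ≤ p 3) :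
    thermalSimplex p ⊆ newCoords '' marginalPolytope p := by
  refine thermalSimplex_subset_of_vertices fun i => ?_
  fin_cases i
  · refine ⟨_, self_mem_marginalPolytope_four hp, ?_⟩
    ext n; simp [simplexVertex]
  · refine ⟨_, mean_pair_mem_marginalPolytope_four hp h01 h12 h23, ?_⟩
    ext n; fin_cases n <;> simp [simplexVertex, newCoords_four] <;> ring
  · refine ⟨_, mean_triple_mem_marginalPolytope_four hp h01 h12 h23 h3, ?_⟩
    ext n; fin_cases n <;> simp [simplexVertex, newCoords_four] <;> ring
  · refine ⟨_, const_mem_marginalPolytope_four hp, ?_⟩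
    ext n; fin_cases n <;> simp [simplexVertex, newCoords_four] <;> linarith

/-! ### Thermal vectors lie in the simplex -/

theorem thermalVector_pos {d : ℕ} (E : Fin d → ℝ) (β : ℝ) (i : Fin d) :
    0 < thermalVector E β i :=
  div_pos (Real.exp_pos _) (Finset.sum_pos (fun _ _ => Real.exp_pos _) ⟨i, Finset.mem_univ i⟩)

theorem sum_thermalVector {d : ℕ} [NeZero d] (E : Fin d → ℝ) (β : ℝ) :
    ∑ i, thermalVector E β i = 1 := by
  simp only [thermalVector, ← Finset.sum_div]
  exact div_self (Finset.sum_pos (fun _ _ => Real.exp_pos _) ⟨0, Finset.mem_univ _⟩).ne'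

theorem antitone_thermalVector {d : ℕ} {E : Fin d → ℝ} (hE : Monotone E) {β : ℝ} (hβ : 0 ≤ β) :
    Antitone (thermalVector E β) := by
  intro i j hij
  have := mul_le_mul_of_nonneg_left (hE hij) hβ
  have hexp : Real.exp (-β * E j) ≤ Real.exp (-β * E i) := Real.exp_le_exp.2 (by linarith)
  exact div_le_div_of_nonneg_right hexp (Finset.sum_nonneg fun _ _ => (Real.exp_pos _).le)

/-! ### Comparison of population gaps at two temperatures -/

theorem Real.exp_smul_sub_one_le {s : ℝ} (h0 : 0 ≤ s) (h1 : s ≤ 1) (x : ℝ) :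
    Real.exp (s * x) - 1 ≤ s * (Real.exp x - 1) := by
  have := convexOn_exp.2 (Set.mem_univ x) (Set.mem_univ 0) h0 (sub_nonneg.2 h1) (by ring)
  simp only [smul_eq_mul, mul_zero, add_zero, Real.exp_zero] at this
  linarith

/-- The upper gap, relative to the lower one, grows as the system is heated. With `β' = s β` and the
factors at level `b` divided out, convexity of `exp` bounds the lower gap at `β'` above, and the
upper gap at `β'` below, by `s` times the same gap at `β`. -/
theorem exp_gap_mul_le {a b c β β' : ℝ} (hab : a ≤ b) (hbc : b ≤ c) (h0 : 0 ≤ β') (h : β' ≤ β)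
    (hβ : 0 < β) :
    (Real.exp (-β' * b) - Real.exp (-β' * a)) * (Real.exp (-β * c) - Real.exp (-β * b)) ≤
      (Real.exp (-β' * c) - Real.exp (-β' * b)) * (Real.exp (-β * b) - Real.exp (-β * a)) := by
  obtain ⟨s, hs0, hs1, rfl⟩ := exists_mul_eq_of_le h0 h
  have hA := Real.exp_smul_sub_one_le hs0 hs1 (β * (b - a))
  have hC := Real.exp_smul_sub_one_le hs0 hs1 (-(β * (c - b)))
  have hA0 : 1 ≤ Real.exp (β * (b - a)) :=
    Real.one_le_exp (mul_nonneg hβ.le (sub_nonneg.2 hab))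
  have hC0 : Real.exp (-(β * (c - b))) ≤ 1 :=
    Real.exp_le_one_iff.2 (neg_nonpos.2 (mul_nonneg hβ.le (sub_nonneg.2 hbc)))
  have e1 : Real.exp (-(s * β) * a) = Real.exp (-(s * β) * b) * Real.exp (s * (β * (b - a))) := by
    rw [← Real.exp_add]; ring_nf
  have e2 : Real.exp (-(s * β) * c) = Real.exp (-(s * β) * b) * Real.exp (s * -(β * (c - b))) := by
    rw [← Real.exp_add]; ring_nf
  have e3 : Real.exp (-β * a) = Real.exp (-β * b) * Real.exp (β * (b - a)) := by
    rw [← Real.exp_add]; ring_nf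
  have e4 : Real.exp (-β * c) = Real.exp (-β * b) * Real.exp (-(β * (c - b))) := by
    rw [← Real.exp_add]; ring_nf
  rw [e1, e2, e3, e4]
  have hP : 0 ≤ Real.exp (-(s * β) * b) * Real.exp (-β * b) := by positivity
  generalize Real.exp (s * (β * (b - a))) = A' at *
  generalize Real.exp (β * (b - a)) = A at *
  generalize Real.exp (s * -(β * (c - b))) = C' at *
  generalize Real.exp (-(β * (c - b))) = C at *
  have h1 : (A' - 1) * (1 - C) ≤ (1 - C') * (A - 1) := by
    nlinarith [mul_le_mul_of_nonneg_right hA (sub_nonneg.2 hC0),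
      mul_le_mul_of_nonneg_right hC (sub_nonneg.2 hA0)]
  have := mul_le_mul_of_nonneg_left h1 hP
  linarith

theorem thermalVector_gap_mul_le {d : ℕ} {E : Fin d → ℝ} (hE : Monotone E) {β β' : ℝ}
    (h0 : 0 ≤ β') (h : β' ≤ β) (hβ : 0 < β) {i j k : Fin d} (hij : i ≤ j) (hjk : j ≤ k) :
    (thermalVector E β' j - thermalVector E β' i) * (thermalVector E β k - thermalVector E β j) ≤
      (thermalVector E β' k - thermalVector E β' j) *
        (thermalVector E β j - thermalVector E β i) := by
  simp only [thermalVector, ← sub_div, div_mul_div_comm]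
  exact div_le_div_of_nonneg_right (exp_gap_mul_le (hE hij) (hE hjk) h0 h hβ)
    (mul_nonneg (Finset.sum_nonneg fun _ _ => (Real.exp_pos _).le)
      (Finset.sum_nonneg fun _ _ => (Real.exp_pos _).le))

/-- Heating populates the top level: after cross-multiplying by the partition functions the
inequality holds term by term. -/
theorem thermalVector_le_of_forall_le {d : ℕ} {E : Fin d → ℝ} {β β' : ℝ} (h : β' ≤ β)
    {l : Fin d} (hl : ∀ i, E i ≤ E l) : thermalVector E β l ≤ thermalVector E β' l := by
  have hZ : ∀ b : ℝ, 0 < ∑ j, Real.exp (-b * E j) := fun b =>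
    Finset.sum_pos (fun _ _ => Real.exp_pos _) ⟨l, Finset.mem_univ l⟩
  rw [thermalVector, thermalVector, div_le_div_iff₀ (hZ _) (hZ _), Finset.mul_sum, Finset.mul_sum]
  refine Finset.sum_le_sum fun i _ => ?_
  rw [← Real.exp_add, ← Real.exp_add, Real.exp_le_exp]
  nlinarith [mul_nonneg (sub_nonneg.2 h) (sub_nonneg.2 (hl i))]

theorem newCoords_eq_sum_gap {d : ℕ} (p : Fin d → ℝ) {n : Fin d} (h : (n : ℕ) + 1 < d) :
    newCoords p n = ∑ i ∈ Finset.Iic n, (p ⟨n + 1, h⟩ - p i) := by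
  simp [newCoords, h]

theorem newCoords_step {d : ℕ} (p : Fin d → ℝ) {n : ℕ} (h : n + 2 < d) :
    newCoords p ⟨n + 1, by omega⟩ =
      newCoords p ⟨n, by omega⟩ + (n + 2) * (p ⟨n + 2, h⟩ - p ⟨n + 1, by omega⟩) := by
  have hI : Finset.Iic (⟨n + 1, by omega⟩ : Fin d) =
      insert ⟨n + 1, by omega⟩ (Finset.Iic (⟨n, by omega⟩ : Fin d)) := by
    ext i
    simp only [Finset.mem_Iic, Finset.mem_insert, Fin.le_def, Fin.ext_iff]
    omega
  have hn : (⟨n + 1, by omega⟩ : Fin d) ∉ Finset.Iic (⟨n, by omega⟩ : Fin d) := by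
    simp [Fin.le_def]
  simp only [newCoords, h, show n + 1 < d by omega, dif_pos, hI,
    Finset.sum_insert hn]
  push_cast
  ring

theorem newCoords_nonpos {d : ℕ} {p : Fin d → ℝ} (hp : Antitone p) {n : Fin d}
    (h : (n : ℕ) + 1 < d) : newCoords p n ≤ 0 := by
  rw [newCoords_eq_sum_gap p h]
  refine Finset.sum_nonpos fun i hi => sub_nonpos.2 (hp ?_)
  have := Finset.mem_Iic.1 hi
  rw [Fin.le_def] at *
  exact this.trans (Nat.le_succ _)

/-- A point whose coordinates are those of `p`, scaled by nonnegative factors that increase to `1`,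
lies in the simplex. -/
theorem mem_thermalSimplex_of_monotone_ratio {d : ℕ} [NeZero d] {p y ρ : Fin d → ℝ}
    (hρ : Monotone ρ) (h0 : ∀ n, 0 ≤ ρ n) (h1 : ∀ n : Fin d, (n : ℕ) + 1 = d → ρ n = 1)
    (hy : ∀ n, y n = ρ n * newCoords p n) : y ∈ thermalSimplex p := by
  have hd : 0 < d := NeZero.pos d
  -- `f` is `ρ` shifted by one with `f 0 = 0`, so that its increments are the barycentric weights;
  -- coordinate `n` only sees the vertices `i ≤ n`, whose weights telescope to `ρ n`.
  let f : ℕ → ℝ := fun k => if h : k - 1 < d then (if k = 0 then 0 else ρ ⟨k - 1, h⟩) else 0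
  have f0 : f 0 = 0 := by simp [f]
  have fs : ∀ (k : ℕ) (h : k < d), f (k + 1) = ρ ⟨k, h⟩ := fun k h => by simp [f, h]
  have htel : ∀ m, ∑ i ∈ Finset.range m, (f (i + 1) - f i) = f m := fun m => by
    rw [Finset.sum_range_sub, f0, sub_zero]
  have hw0 : ∀ i : Fin d, 0 ≤ f (i + 1) - f i := by
    rintro ⟨i, hi⟩
    rw [fs i hi, sub_nonneg]
    cases i with
    | zero => rw [f0]; exact h0 _
    | succ i => rw [fs i (by omega)]; exact hρ (by simp [Fin.le_def])
  have hw1 : ∑ i : Fin d, (f (i + 1) - f i) = 1 := by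
    rw [Fin.sum_univ_eq_sum_range (fun i => f (i + 1) - f i), htel]
    obtain ⟨k, rfl⟩ := Nat.exists_eq_succ_of_ne_zero hd.ne'
    rw [fs k (Nat.lt_succ_self k), h1 _ rfl]
  have := (convex_convexHull ℝ (Set.range (simplexVertex p))).sum_mem (t := Finset.univ)
    (fun i _ => hw0 i) hw1 (fun i _ => subset_convexHull ℝ _ ⟨i, rfl⟩)
  suffices hsum : y = ∑ i : Fin d, (f (i + 1) - f i) • simplexVertex p i by rwa [hsum]
  ext n
  rw [hy, Finset.sum_apply]
  have hite : ∀ i : Fin d, ((f (i + 1) - f i) • simplexVertex p i) n =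
      (if (i : ℕ) ∈ Finset.range (n + 1) then f (i + 1) - f i else 0) * newCoords p n := by
    intro i
    by_cases h : n < i
    · have h' : ¬ (i : ℕ) < n + 1 := by rw [Fin.lt_def] at h; omega
      simp [simplexVertex, h, h']
    · have h' : (i : ℕ) < n + 1 := by rw [Fin.lt_def] at h; omega
      simp [simplexVertex, h, h']
  rw [Finset.sum_congr rfl fun i _ => hite i, ← Finset.sum_mul,
    Fin.sum_univ_eq_sum_range (fun i => if i ∈ Finset.range (n + 1) then f (i + 1) - f i else 0),
    Finset.sum_ite_mem, Finset.inter_eq_right.2 (Finset.range_subset_range.2 n.2), htel,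
    fs n n.2]

theorem newCoords_thermalVector_mem_thermalSimplex {d : ℕ} [NeZero d] {E : Fin d → ℝ}
    (hE : Monotone E) {β β' : ℝ} (h0 : 0 ≤ β') (h : β' ≤ β) :
    newCoords (thermalVector E β') ∈ thermalSimplex (thermalVector E β) := by
  rcases (h0.trans h).eq_or_lt with hβ | hβ
  · obtain rfl : β' = β := le_antisymm h (hβ ▸ h0)
    refine subset_convexHull ℝ _ ⟨0, ?_⟩
    ext n
    simp [simplexVertex]
  set p := thermalVector E β with hp
  set p' := thermalVector E β' with hp'
  have hpa : Antitone p := antitone_thermalVector hE hβ.le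
  have hpa' : Antitone p' := antitone_thermalVector hE h0
  have hlast : ∀ (q : Fin d → ℝ) (n : Fin d), ¬ (n : ℕ) + 1 < d → ∑ i, q i = 1 →
      newCoords q n = -1 := fun q n hn hq => by simp [newCoords, hn, hq]
  have hp1 : ∑ i, p i = 1 := sum_thermalVector E β
  have hp1' : ∑ i, p' i = 1 := sum_thermalVector E β'
  have hnn : ∀ n, 0 ≤ newCoords p' n / newCoords p n := by
    intro n
    by_cases hn : (n : ℕ) + 1 < d
    · exact div_nonneg_of_nonpos (newCoords_nonpos hpa' hn) (newCoords_nonpos hpa hn)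
    · rw [hlast p n hn hp1, hlast p' n hn hp1']; norm_num
  refine mem_thermalSimplex_of_monotone_ratio (ρ := fun n => newCoords p' n / newCoords p n)
    ?_ hnn ?_ ?_
  · obtain ⟨k, rfl⟩ := Nat.exists_eq_succ_of_ne_zero (NeZero.ne d)
    refine Fin.monotone_iff_le_succ.2 fun i => ?_
    -- A vanishing denominator makes the ratio 0 by convention, below the nonnegative next ratio.
    rcases (newCoords_nonpos hpa (n := i.castSucc) (by simp)).eq_or_lt with hx | hx
    · simpa [hx] using hnn i.succ
    by_cases hi : (i : ℕ) + 2 < k + 1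
    · have hs := newCoords_step p (n := i) hi
      have hs' := newCoords_step p' (n := i) hi
      change newCoords p i.succ = newCoords p i.castSucc + _ at hs
      change newCoords p' i.succ = newCoords p' i.castSucc + _ at hs'
      have hgap : p ⟨i + 2, hi⟩ - p ⟨i + 1, by omega⟩ ≤ 0 :=
        sub_nonpos.2 (hpa (by simp [Fin.le_def]))
      have hneg : newCoords p i.succ < 0 := by
        rw [hs]
        nlinarith [mul_nonneg (by positivity : (0 : ℝ) ≤ (i : ℝ) + 2) (neg_nonneg.2 hgap)]
      -- Mediant argument: passing from `x_n` to `x_{n+1}` adds `n + 2` times the next gap, so it is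
      -- enough that this gap's ratio dominates that of `x_n`. Since `x_n` is a sum of gaps ending
      -- at level `n + 1`, the gap comparison applies termwise.
      have key : newCoords p' i.castSucc * (p ⟨i + 2, hi⟩ - p ⟨i + 1, by omega⟩) ≤
          (p' ⟨i + 2, hi⟩ - p' ⟨i + 1, by omega⟩) * newCoords p i.castSucc := by
        rw [newCoords_eq_sum_gap p (n := i.castSucc) (by simp),
          newCoords_eq_sum_gap p' (n := i.castSucc) (by simp), Finset.sum_mul, Finset.mul_sum]
        refine Finset.sum_le_sum fun j hj => thermalVector_gap_mul_le hE h0 h hβ ?_ ?_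
        · have := Finset.mem_Iic.1 hj
          simp only [Fin.le_def, Fin.val_castSucc] at *
          omega
        · simp [Fin.le_def]
      rw [← neg_div_neg_eq, ← neg_div_neg_eq (newCoords p' i.succ),
        div_le_div_iff₀ (neg_pos.2 hx) (neg_pos.2 hneg), hs, hs']
      nlinarith [mul_le_mul_of_nonneg_left key (by positivity : (0 : ℝ) ≤ (i : ℝ) + 2)]
    -- Last comparison, against the ratio 1: by normalization `x_{d-2} = d * p_{d-1} - 1`, and the
    -- top population grows under heating.
    · rw [hlast p i.succ (by rw [Fin.val_succ]; omega) hp1,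
        hlast p' i.succ (by rw [Fin.val_succ]; omega) hp1',
        div_self (by norm_num), div_le_one_of_neg hx]
      have hik : (i : ℕ) + 1 = k := by omega
      have hsucc : (⟨(i.castSucc : ℕ) + 1, by simp⟩ : Fin (k + 1)) = Fin.last k := by
        ext; simpa using hik
      have hIic : insert (Fin.last k) (Finset.Iic i.castSucc) = Finset.univ := by
        ext j
        simp only [Finset.mem_insert, Finset.mem_Iic, Fin.le_def, Fin.ext_iff, Fin.val_last,
          Fin.val_castSucc, Finset.mem_univ, iff_true]
        omega
      have hnot : Fin.last k ∉ Finset.Iic i.castSucc := by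
        simp [Fin.le_def]
      have hco : ∀ q : Fin (k + 1) → ℝ, ∑ j, q j = 1 →
          newCoords q i.castSucc = (k + 1) * q (Fin.last k) - 1 := by
        intro q hq
        rw [← hIic, Finset.sum_insert hnot] at hq
        simp only [newCoords, Fin.val_castSucc, show (i : ℕ) + 1 < k + 1 by omega, dif_pos]
        rw [show (⟨(i : ℕ) + 1, by omega⟩ : Fin (k + 1)) = Fin.last k from hsucc,
          show ((i : ℕ) : ℝ) + 1 = k from mod_cast hik]
        linarith
      rw [hco p hp1, hco p' hp1']
      have := thermalVector_le_of_forall_le h (fun j => hE (Fin.le_last j))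
      have hk : (0 : ℝ) ≤ k + 1 := by positivity
      linarith [mul_le_mul_of_nonneg_left this hk]
  · intro n hn
    rw [hlast p n (by omega) hp1, hlast p' n (by omega) hp1', div_self (by norm_num)]
  · intro n
    by_cases hx : newCoords p n = 0
    swap
    · exact (div_mul_cancel₀ _ hx).symm
    by_cases hn : (n : ℕ) + 1 < d
    swap
    · rw [hlast p n hn hp1] at hx; norm_num at hx
    rw [hx, mul_zero, newCoords_eq_sum_gap p' hn]
    rw [newCoords_eq_sum_gap p hn] at hx
    -- If `x_n(β) = 0`, all its gaps vanish; as `β > 0` the levels `0, …, n + 1` are degenerate, so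
    -- the gaps vanish at `β'` too.
    refine Finset.sum_eq_zero fun i hi => ?_
    have hle : ∀ i ∈ Finset.Iic n, p ⟨n + 1, hn⟩ - p i ≤ 0 := fun i hi =>
      sub_nonpos.2 (hpa ((Finset.mem_Iic.1 hi).trans (by simp [Fin.le_def])))
    have := (Finset.sum_eq_zero_iff_of_nonpos hle).1 hx i hi
    have hZ : (∑ j, Real.exp (-β * E j)) ≠ 0 :=
      (Finset.sum_pos (fun _ _ => Real.exp_pos _) ⟨0, Finset.mem_univ _⟩).ne'
    rw [hp, thermalVector, thermalVector, ← sub_div, div_eq_zero_iff, or_iff_left hZ,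
      sub_eq_zero, Real.exp_eq_exp, mul_right_inj' (neg_ne_zero.2 hβ.ne')] at this
    rw [hp', thermalVector, thermalVector, this, sub_self]

/-! ### Block-diagonal unitaries and their marginals -/

section Marginals

variable {d : ℕ}

/-- The copy of `V` on the traced factor disappears by unitarity, reducing marginals to the energy
basis. -/
theorem partialTraceB_kronecker_conj {V : Matrix (Fin d) (Fin d) ℂ}
    (hV : V ∈ Matrix.unitaryGroup (Fin d) ℂ) (X : Matrix (Fin d × Fin d) (Fin d × Fin d) ℂ) :
    partialTraceB ((V ⊗ₖ V) * X * (V ⊗ₖ V)ᴴ) = V * partialTraceB X * Vᴴ := by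
  have hcol : ∀ b b', ∑ k, V k b * star (V k b') = if b = b' then 1 else 0 := by
    intro b b'
    have := congrFun (congrFun (Matrix.mem_unitaryGroup_iff'.1 hV) b') b
    simpa [Matrix.mul_apply, Matrix.one_apply, mul_comm, eq_comm] using this
  ext i j
  simp only [partialTraceB, Matrix.of_apply, Matrix.mul_apply, Matrix.conjTranspose_apply,
    Matrix.kroneckerMap_apply, Finset.sum_mul, Finset.mul_sum, Fintype.sum_prod_type, star_mul']
  calc _ = ∑ a', ∑ b', ∑ a, ∑ b, V i a * X (a, b) (a', b') * star (V j a') *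
        ∑ k, V k b * star (V k b') := by
        simp only [Finset.mul_sum]
        rw [Finset.sum_comm]
        refine Finset.sum_congr rfl fun a' _ => ?_
        rw [Finset.sum_comm]
        refine Finset.sum_congr rfl fun b' _ => ?_
        rw [Finset.sum_comm]
        refine Finset.sum_congr rfl fun a _ => ?_
        rw [Finset.sum_comm]
        refine Finset.sum_congr rfl fun b _ => Finset.sum_congr rfl fun k _ => ?_
        ring
    _ = _ := by
        simp only [hcol, mul_ite, mul_one, mul_zero, Finset.sum_ite_eq', Finset.mem_univ, if_true]
        refine Finset.sum_congr rfl fun a' _ => ?_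
        rw [Finset.sum_comm]

theorem partialTraceA_eq_partialTraceB (X : Matrix (Fin d × Fin d) (Fin d × Fin d) ℂ) :
    partialTraceA X = partialTraceB (X.submatrix Prod.swap Prod.swap) :=
  rfl

theorem partialTraceA_kronecker_conj {V : Matrix (Fin d) (Fin d) ℂ}
    (hV : V ∈ Matrix.unitaryGroup (Fin d) ℂ) (X : Matrix (Fin d × Fin d) (Fin d × Fin d) ℂ) :
    partialTraceA ((V ⊗ₖ V) * X * (V ⊗ₖ V)ᴴ) = V * partialTraceA X * Vᴴ := by
  have hswap : (V ⊗ₖ V).submatrix Prod.swap Prod.swap = V ⊗ₖ V := by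
    ext x y
    simp [mul_comm]
  rw [partialTraceA_eq_partialTraceB, partialTraceA_eq_partialTraceB,
    ← partialTraceB_kronecker_conj hV]
  congr 1
  rw [← Matrix.submatrix_mul_equiv _ _ Prod.swap (Equiv.prodComm (Fin d) (Fin d)) Prod.swap,
    ← Matrix.submatrix_mul_equiv _ _ Prod.swap (Equiv.prodComm (Fin d) (Fin d)) _]
  change (V ⊗ₖ V).submatrix Prod.swap Prod.swap * X.submatrix Prod.swap Prod.swap *
    ((V ⊗ₖ V).submatrix Prod.swap Prod.swap)ᴴ = _
  rw [hswap]

theorem kronecker_self_mem_unitaryGroup {V : Matrix (Fin d) (Fin d) ℂ}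
    (hV : V ∈ Matrix.unitaryGroup (Fin d) ℂ) :
    V ⊗ₖ V ∈ Matrix.unitaryGroup (Fin d × Fin d) ℂ :=
  Matrix.kronecker_mem_unitary hV hV

theorem gibbsState_eq_conj {H V : Matrix (Fin d) (Fin d) ℂ} {E : Fin d → ℝ}
    (hV : V ∈ Matrix.unitaryGroup (Fin d) ℂ)
    (hH : H = V * Matrix.diagonal (fun i => (E i : ℂ)) * Vᴴ) (β : ℝ) :
    gibbsState H β = V * Matrix.diagonal (fun i => (thermalVector E β i : ℂ)) * Vᴴ := by
  have hV1 : Vᴴ * V = 1 := Matrix.mem_unitaryGroup_iff'.1 hV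
  have hV2 : V * Vᴴ = 1 := Matrix.mem_unitaryGroup_iff.1 hV
  have hinv : V⁻¹ = Vᴴ := Matrix.inv_eq_right_inv hV2
  have hexp : NormedSpace.exp (-(β : ℂ) • H) =
      V * Matrix.diagonal (fun i => (Real.exp (-β * E i) : ℂ)) * Vᴴ := by
    have : -(β : ℂ) • H = V * Matrix.diagonal (fun i => ((-β * E i : ℝ) : ℂ)) * V⁻¹ := by
      rw [hH, hinv, ← Matrix.smul_mul, ← Matrix.mul_smul, ← Matrix.diagonal_smul]
      congr 3
      ext i
      simp
    rw [this, Matrix.exp_conj _ _ ((Matrix.isUnit_iff_isUnit_det _).2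
      (Matrix.isUnit_det_of_left_inverse hV1)), Matrix.exp_diagonal, hinv]
    congr 3
    ext i
    rw [Pi.coe_exp, ← Complex.exp_eq_exp_ℂ, Complex.ofReal_exp]
  have htr : (NormedSpace.exp (-(β : ℂ) • H)).trace = ((∑ j, Real.exp (-β * E j) : ℝ) : ℂ) := by
    rw [hexp, Matrix.trace_mul_comm, ← Matrix.mul_assoc, hV1, Matrix.one_mul,
      Matrix.trace_diagonal]
    push_cast
    rfl
  rw [gibbsState, htr, hexp, ← Matrix.smul_mul, ← Matrix.mul_smul, ← Matrix.diagonal_smul]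
  congr 3
  ext i
  simp [thermalVector, div_eq_inv_mul]

/-! ### Block matrices over the locally classical subspaces -/

/-- The bijection `(j, n) ↦ (j, j + n)` sorting the product basis into the bases of the locally
classical subspaces. -/
def lcsEquiv (d : ℕ) [NeZero d] : Fin d × Fin d ≃ Fin d × Fin d where
  toFun x := (x.1, x.1 + x.2)
  invFun x := (x.1, x.2 - x.1)
  left_inv x := by simp
  right_inv x := by simp

/-- The block-diagonal matrix acting by `W n` on the `n`-th locally classical subspace of the
standard basis. -/
def lcsBlockMatrix [NeZero d] (W : Fin d → Matrix (Fin d) (Fin d) ℂ) :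
    Matrix (Fin d × Fin d) (Fin d × Fin d) ℂ :=
  (Matrix.blockDiagonal W).submatrix (lcsEquiv d).symm (lcsEquiv d).symm

variable [NeZero d]

theorem lcsBlockMatrix_apply (W : Fin d → Matrix (Fin d) (Fin d) ℂ) (a b a' b' : Fin d) :
    lcsBlockMatrix W (a, b) (a', b') = if b - a = b' - a' then W (b - a) a a' else 0 := by
  simp [lcsBlockMatrix, lcsEquiv, Matrix.blockDiagonal_apply]

theorem lcsBlockMatrix_mul (W W' : Fin d → Matrix (Fin d) (Fin d) ℂ) :
    lcsBlockMatrix W * lcsBlockMatrix W' = lcsBlockMatrix fun n => W n * W' n := by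
  simp [lcsBlockMatrix, Matrix.submatrix_mul_equiv, Matrix.blockDiagonal_mul]

theorem lcsBlockMatrix_conjTranspose (W : Fin d → Matrix (Fin d) (Fin d) ℂ) :
    (lcsBlockMatrix W)ᴴ = lcsBlockMatrix fun n => (W n)ᴴ := by
  simp [lcsBlockMatrix, Matrix.conjTranspose_submatrix, Matrix.blockDiagonal_conjTranspose]

theorem lcsBlockMatrix_mem_unitaryGroup {W : Fin d → Matrix (Fin d) (Fin d) ℂ}
    (hW : ∀ n, W n ∈ Matrix.unitaryGroup (Fin d) ℂ) :
    lcsBlockMatrix W ∈ Matrix.unitaryGroup (Fin d × Fin d) ℂ := by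
  rw [Matrix.mem_unitaryGroup_iff, Matrix.star_eq_conjTranspose, lcsBlockMatrix_conjTranspose,
    lcsBlockMatrix_mul]
  have : (fun n => W n * (W n)ᴴ) = 1 :=
    funext fun n => Matrix.mem_unitaryGroup_iff.1 (hW n)
  rw [this, lcsBlockMatrix, Matrix.blockDiagonal_one, Matrix.submatrix_one_equiv]

theorem diagonal_kronecker_diagonal_eq_lcsBlockMatrix (p : Fin d → ℝ) :
    Matrix.diagonal (fun i => (p i : ℂ)) ⊗ₖ Matrix.diagonal (fun i => (p i : ℂ)) =
      lcsBlockMatrix fun n : Fin d => Matrix.diagonal fun i => (lcsVector p n i : ℂ) := by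
  ext ⟨a, b⟩ ⟨a', b'⟩
  rw [lcsBlockMatrix_apply, Matrix.kroneckerMap_apply, Matrix.diagonal_apply,
    Matrix.diagonal_apply, Matrix.diagonal_apply]
  rcases eq_or_ne a a' with rfl | h
  · rcases eq_or_ne b b' with rfl | h'
    · simp [lcsVector]
    · simp [h']
  · simp [h]

theorem partialTraceB_lcsBlockMatrix (X : Fin d → Matrix (Fin d) (Fin d) ℂ) :
    partialTraceB (lcsBlockMatrix X) = Matrix.diagonal fun i => ∑ n, X n i i := by
  ext i j
  simp only [partialTraceB, Matrix.of_apply, lcsBlockMatrix_apply, sub_right_inj]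
  rcases eq_or_ne i j with rfl | h
  · simp only [if_true, Matrix.diagonal_apply_eq]
    exact Equiv.sum_comp (Equiv.subRight i) fun n => X n i i
  · simp [h]

/-- The vector `|k⟩ ⊗ |i⟩` lies in block `i - k`, where it carries the index `k` of the first
factor. -/
theorem partialTraceA_lcsBlockMatrix (X : Fin d → Matrix (Fin d) (Fin d) ℂ) :
    partialTraceA (lcsBlockMatrix X) = Matrix.diagonal fun i => ∑ k, X (i - k) k k := by
  ext i j
  simp only [partialTraceA, Matrix.of_apply, lcsBlockMatrix_apply, sub_left_inj]
  rcases eq_or_ne i j with rfl | h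
  · simp
  · simp [h]

theorem isLCSBlockDiagonal_kronecker_conj {V : Matrix (Fin d) (Fin d) ℂ}
    (hV : V ∈ Matrix.unitaryGroup (Fin d) ℂ) (W : Fin d → Matrix (Fin d) (Fin d) ℂ) :
    IsLCSBlockDiagonal V ((V ⊗ₖ V) * lcsBlockMatrix W * (V ⊗ₖ V)ᴴ) := by
  have hgen : ∀ i j : Fin d, (fun x : Fin d × Fin d => V x.1 j * V x.2 (j + i)) =
      (V ⊗ₖ V) *ᵥ Pi.single (j, j + i) 1 := by
    intro i j
    ext x
    simp
  intro i
  suffices h : locallyClassicalSubspace V i ≤ (locallyClassicalSubspace V i).comap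
      ((V ⊗ₖ V) * lcsBlockMatrix W * (V ⊗ₖ V)ᴴ).mulVecLin from fun x hx => h hx
  refine Submodule.span_le.2 ?_
  rintro _ ⟨j, rfl⟩
  have hK : (V ⊗ₖ V)ᴴ * (V ⊗ₖ V) = 1 :=
    Matrix.mem_unitaryGroup_iff'.1 (kronecker_self_mem_unitaryGroup hV)
  have hcol : lcsBlockMatrix W *ᵥ Pi.single (j, j + i) 1 =
      ∑ a, W i a j • Pi.single (a, a + i) (1 : ℂ) := by
    ext ⟨a, b⟩
    simp only [Matrix.mulVec_single_one, Matrix.col_apply, lcsBlockMatrix_apply,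
      add_sub_cancel_left, Finset.sum_apply, Pi.smul_apply, Pi.single_apply, Prod.mk.injEq,
      smul_eq_mul, mul_ite, mul_one, mul_zero]
    rw [Finset.sum_eq_single a (fun c _ hc => by simp [hc.symm]) (by simp)]
    simp only [true_and, sub_eq_iff_eq_add']
    split_ifs with h
    · simp [h]
    · rfl
  have himg : ((V ⊗ₖ V) * lcsBlockMatrix W * (V ⊗ₖ V)ᴴ) *ᵥ
      (fun x : Fin d × Fin d => V x.1 j * V x.2 (j + i)) =
      ∑ a, W i a j • fun x : Fin d × Fin d => V x.1 a * V x.2 (a + i) := by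
    simp only [hgen, Matrix.mulVec_mulVec]
    rw [Matrix.mul_assoc, hK, Matrix.mul_one, ← Matrix.mulVec_mulVec, hcol, Matrix.mulVec_sum]
    simp only [Matrix.mulVec_smul]
  simp only [Submodule.comap_coe, Set.mem_preimage, Matrix.mulVecLin_apply, SetLike.mem_coe]
  rw [himg]
  exact Submodule.sum_mem _ fun a _ => Submodule.smul_mem _ _ (Submodule.subset_span ⟨a, rfl⟩)

theorem evolvedState_kronecker_conj {H V : Matrix (Fin d) (Fin d) ℂ} {E : Fin d → ℝ}
    (hV : V ∈ Matrix.unitaryGroup (Fin d) ℂ)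
    (hH : H = V * Matrix.diagonal (fun i => (E i : ℂ)) * Vᴴ) (β : ℝ)
    (W : Fin d → Matrix (Fin d) (Fin d) ℂ) :
    evolvedState H β ((V ⊗ₖ V) * lcsBlockMatrix W * (V ⊗ₖ V)ᴴ) =
      (V ⊗ₖ V) * lcsBlockMatrix (fun n => W n *
        Matrix.diagonal (fun i => (lcsVector (thermalVector E β) n i : ℂ)) * (W n)ᴴ) *
        (V ⊗ₖ V)ᴴ := by
  have hK : (V ⊗ₖ V)ᴴ * (V ⊗ₖ V) = 1 :=
    Matrix.mem_unitaryGroup_iff'.1 (kronecker_self_mem_unitaryGroup hV)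
  rw [evolvedState, gibbsState_eq_conj hV hH, Matrix.mul_kronecker_mul, Matrix.mul_kronecker_mul,
    diagonal_kronecker_diagonal_eq_lcsBlockMatrix, ← Matrix.conjTranspose_kronecker,
    Matrix.conjTranspose_mul, Matrix.conjTranspose_mul, Matrix.conjTranspose_conjTranspose,
    lcsBlockMatrix_conjTranspose, ← lcsBlockMatrix_mul, ← lcsBlockMatrix_mul]
  generalize V ⊗ₖ V = K at *
  have hK' : ∀ X, Kᴴ * (K * X) = X := fun X => by rw [← Matrix.mul_assoc, hK, Matrix.one_mul]
  simp only [Matrix.mul_assoc, hK']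

/-- Diagonal marginals are reachable by block-diagonal unitaries as soon as the populations of
the locally classical subspaces can be chosen in the respective permutohedra. -/
theorem exists_hasSymmetricMarginals {H V : Matrix (Fin d) (Fin d) ℂ} {E : Fin d → ℝ}
    (hV : V ∈ Matrix.unitaryGroup (Fin d) ℂ)
    (hH : H = V * Matrix.diagonal (fun i => (E i : ℂ)) * Vᴴ) (β : ℝ) {v : Fin d → ℝ}
    (y : Fin d → Fin d → ℝ)
    (hy : ∀ n : Fin d, y n ∈ permutohedron (lcsVector (thermalVector E β) n))
    (hA : ∀ i, ∑ n, y n i = v i) (hB : ∀ i, ∑ k, y (i - k) k = v i) :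
    ∃ U : Matrix (Fin d × Fin d) (Fin d × Fin d) ℂ, IsLCSBlockDiagonal V U ∧
      HasSymmetricMarginals H β U (V * Matrix.diagonal (fun i => (v i : ℂ)) * Vᴴ) := by
  choose W hW hWy using fun n => isOrthogonalDiagonal_of_mem_permutohedron (hy n)
  have hWu : ∀ n, (W n).map ((↑) : ℝ → ℂ) ∈ Matrix.unitaryGroup (Fin d) ℂ := by
    intro n
    rw [Matrix.mem_unitaryGroup_iff, ← Matrix.ext_iff]
    intro i j
    have := congrArg ((↑) : ℝ → ℂ) (Matrix.mem_orthogonalGroup_iff_rows.1 (hW n) i j)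
    push_cast at this
    simpa [Matrix.mul_apply, Matrix.one_apply, apply_ite Complex.ofReal] using this
  have hdiag : ∀ n i, ((W n).map ((↑) : ℝ → ℂ) *
      Matrix.diagonal (fun i => (lcsVector (thermalVector E β) n i : ℂ)) *
      ((W n).map ((↑) : ℝ → ℂ))ᴴ) i i = (y n i : ℂ) := by
    intro n i
    rw [← hWy n i, Matrix.mul_apply]
    push_cast
    refine Finset.sum_congr rfl fun l _ => ?_
    simp [Matrix.mul_diagonal]
    ring
  have hK := kronecker_self_mem_unitaryGroup hV
  refine ⟨_, isLCSBlockDiagonal_kronecker_conj hV fun n => (W n).map ((↑) : ℝ → ℂ),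
    mul_mem (mul_mem hK (lcsBlockMatrix_mem_unitaryGroup hWu)) (Unitary.star_mem hK), ?_, ?_⟩
  · rw [evolvedState_kronecker_conj hV hH, partialTraceB_kronecker_conj hV,
      partialTraceB_lcsBlockMatrix]
    simp only [hdiag, ← hA]
    push_cast
    rfl
  · rw [evolvedState_kronecker_conj hV hH, partialTraceA_kronecker_conj hV,
      partialTraceA_lcsBlockMatrix]
    simp only [hdiag, ← hB]
    push_cast
    rfl

end Marginals

/-! ### Two qutrits and two ququarts -/

theorem exists_hasSymmetricMarginals_three {H V : Matrix (Fin 3) (Fin 3) ℂ} {E : Fin 3 → ℝ}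
    (hV : V ∈ Matrix.unitaryGroup (Fin 3) ℂ)
    (hH : H = V * Matrix.diagonal (fun i => (E i : ℂ)) * Vᴴ) (β : ℝ) {v : Fin 3 → ℝ}
    (hv : v ∈ marginalPolytope (thermalVector E β)) :
    ∃ U : Matrix (Fin 3 × Fin 3) (Fin 3 × Fin 3) ℂ, IsLCSBlockDiagonal V U ∧
      HasSymmetricMarginals H β U (V * Matrix.diagonal (fun i => (v i : ℂ)) * Vᴴ) := by
  obtain ⟨y₀, h₀, y₁, h₁, rfl⟩ := mem_marginalPolytope_three_iff.1 hv
  have hshift : lcsVector (thermalVector E β) 2 =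
      lcsVector (thermalVector E β) 1 ∘ Equiv.subRight 1 := by
    ext i
    fin_cases i <;> exact mul_comm _ _
  -- Block 2 is block 1 with the factors exchanged, so it receives the shifted populations of block
  -- 1.
  refine exists_hasSymmetricMarginals hV hH β ![y₀, y₁, y₁ ∘ Equiv.subRight 1] (fun n => ?_)
    (fun i => ?_) (fun i => ?_)
  · fin_cases n
    · exact h₀
    · exact h₁
    · change _ ∈ permutohedron (lcsVector _ 2)
      rw [hshift, permutohedron_comp_perm]
      exact comp_mem_permutohedron h₁ _
  · simp [Fin.sum_univ_three, add_assoc]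
  · fin_cases i <;> simp [Fin.sum_univ_three, show (-1 : Fin 3) = 2 from rfl,
      show (-2 : Fin 3) = 1 from rfl, show (1 - 2 : Fin 3) = 2 from rfl] <;> ring

theorem exists_hasSymmetricMarginals_four {H V : Matrix (Fin 4) (Fin 4) ℂ} {E : Fin 4 → ℝ}
    (hV : V ∈ Matrix.unitaryGroup (Fin 4) ℂ)
    (hH : H = V * Matrix.diagonal (fun i => (E i : ℂ)) * Vᴴ) (β : ℝ) {v : Fin 4 → ℝ}
    (hv : v ∈ marginalPolytope (thermalVector E β)) :
    ∃ U : Matrix (Fin 4 × Fin 4) (Fin 4 × Fin 4) ℂ, IsLCSBlockDiagonal V U ∧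
      HasSymmetricMarginals H β U (V * Matrix.diagonal (fun i => (v i : ℂ)) * Vᴴ) := by
  obtain ⟨y₀, h₀, y₁, h₁, y₂, h₂, rfl⟩ := mem_marginalPolytope_four_iff.1 hv
  have hshift : lcsVector (thermalVector E β) 3 =
      lcsVector (thermalVector E β) 1 ∘ Equiv.subRight 1 := by
    ext i
    fin_cases i <;> exact mul_comm _ _
  -- Blocks 1 and 3 are paired as for qutrits. Block 2 is its own partner, so its populations are
  -- averaged with their shift by 2; this is the factor `1 / 2` in the polytope.
  refine exists_hasSymmetricMarginals hV hH β
    ![y₀, y₁, (1 / 2 : ℝ) • y₂ + (1 / 2 : ℝ) • (y₂ ∘ Equiv.subRight 2), y₁ ∘ Equiv.subRight 1]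
    (fun n => ?_) (fun i => ?_) (fun i => ?_)
  · fin_cases n
    · exact h₀
    · exact h₁
    · exact convex_permutohedron _ h₂ (comp_mem_permutohedron h₂ _) (by norm_num) (by norm_num)
        (by norm_num)
    · change _ ∈ permutohedron (lcsVector _ 3)
      rw [hshift, permutohedron_comp_perm]
      exact comp_mem_permutohedron h₁ _
  · simp [Fin.sum_univ_four]
    ring
  · fin_cases i <;> simp [Fin.sum_univ_four, show (-1 : Fin 4) = 3 from rfl,
      show (-2 : Fin 4) = 2 from rfl, show (-3 : Fin 4) = 1 from rfl,
      show (1 - 2 : Fin 4) = 3 from rfl, show (1 - 3 : Fin 4) = 2 from rfl,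
      show (2 - 3 : Fin 4) = 3 from rfl] <;> ring

theorem newCoords_injective_three : Function.Injective (newCoords : (Fin 3 → ℝ) → Fin 3 → ℝ) := by
  intro p q h
  rw [newCoords_three, newCoords_three] at h
  have h0 := congrFun h 0
  have h1 := congrFun h 1
  have h2 := congrFun h 2
  simp at h0 h1 h2
  ext i
  fin_cases i <;> simp <;> linarith

theorem newCoords_injective_four : Function.Injective (newCoords : (Fin 4 → ℝ) → Fin 4 → ℝ) := by
  intro p q h
  rw [newCoords_four, newCoords_four] at h
  have h0 := congrFun h 0
  have h1 := congrFun h 1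
  have h2 := congrFun h 2
  have h3 := congrFun h 3
  simp at h0 h1 h2 h3
  ext i
  fin_cases i <;> simp <;> linarith

/-- A Hermitian matrix is diagonalized by a unitary matrix with its eigenvalues in increasing
order. -/
theorem Matrix.IsHermitian.exists_eq_conj_diagonal_monotone {d : ℕ} {H : Matrix (Fin d) (Fin d) ℂ}
    (hH : H.IsHermitian) : ∃ V ∈ Matrix.unitaryGroup (Fin d) ℂ, ∃ E : Fin d → ℝ, Monotone E ∧
      H = V * Matrix.diagonal (fun i => (E i : ℂ)) * Vᴴ := by
  let σ := Tuple.sort hH.eigenvalues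
  let U : Matrix (Fin d) (Fin d) ℂ := hH.eigenvectorUnitary
  have hU : U * Uᴴ = 1 := Matrix.mem_unitaryGroup_iff.1 hH.eigenvectorUnitary.2
  refine ⟨U.submatrix id σ, ?_, hH.eigenvalues ∘ σ, Tuple.monotone_sort _, ?_⟩
  · rw [Matrix.mem_unitaryGroup_iff, Matrix.star_eq_conjTranspose, Matrix.conjTranspose_submatrix,
      Matrix.submatrix_mul_equiv, hU, Matrix.submatrix_id_id]
  · have hD : Matrix.diagonal (fun i => (((hH.eigenvalues ∘ σ) i : ℝ) : ℂ)) =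
        (Matrix.diagonal fun i => (hH.eigenvalues i : ℂ)).submatrix σ σ := by
      rw [Matrix.submatrix_diagonal_equiv]
      rfl
    rw [hD, Matrix.conjTranspose_submatrix, Matrix.submatrix_mul_equiv,
      Matrix.submatrix_mul_equiv, Matrix.submatrix_id_id]
    conv_lhs => rw [hH.spectral_theorem, Unitary.conjStarAlgAut_apply]
    rfl

theorem mainTheorem2 {d : ℕ} [NeZero d] (hd : d = 3 ∨ d = 4)
    (H : Matrix (Fin d) (Fin d) ℂ) (hH : H.IsHermitian) (β : ℝ) (hβ : 0 ≤ β) :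
    (∀ (V : Matrix (Fin d) (Fin d) ℂ) (E : Fin d → ℝ),
        V ∈ Matrix.unitaryGroup (Fin d) ℂ → Monotone E →
        H = V * Matrix.diagonal (fun i => (E i : ℂ)) * Vᴴ →
        (thermalSimplex (thermalVector E β) ⊆
            newCoords '' marginalPolytope (thermalVector E β)) ∧
        (∀ v ∈ marginalPolytope (thermalVector E β),
          ∃ U : Matrix (Fin d × Fin d) (Fin d × Fin d) ℂ,
            IsLCSBlockDiagonal V U ∧
            HasSymmetricMarginals H β U (V * Matrix.diagonal (fun i => (v i : ℂ)) * Vᴴ)) ∧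
        (∀ β' : ℝ, 0 ≤ β' → β' ≤ β →
          newCoords (thermalVector E β') ∈ thermalSimplex (thermalVector E β) ∧
          thermalVector E β' ∈ marginalPolytope (thermalVector E β) ∧
          ∃ U : Matrix (Fin d × Fin d) (Fin d × Fin d) ℂ,
            IsLCSBlockDiagonal V U ∧ IsSTU H β β' U)) ∧
    (∀ β' : ℝ, 0 ≤ β' → β' ≤ β →
      ∃ U : Matrix (Fin d × Fin d) (Fin d × Fin d) ℂ, IsSTU H β β' U) := by
  have hinj : Function.Injective (newCoords : (Fin d → ℝ) → Fin d → ℝ) := by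
    rcases hd with rfl | rfl
    exacts [newCoords_injective_three, newCoords_injective_four]
  -- The second conjunct follows from the first, applied to an ordered eigenbasis of `H`.
  rw [and_iff_left_of_imp]
  · intro V E hV hE hHV
    have hsub : thermalSimplex (thermalVector E β) ⊆
        newCoords '' marginalPolytope (thermalVector E β) := by
      have hsum := sum_thermalVector E β
      have hanti := antitone_thermalVector hE hβ
      rcases hd with rfl | rfl
      · rw [Fin.sum_univ_three] at hsum
        exact thermalSimplex_subset_three hsum
      · rw [Fin.sum_univ_four] at hsum
        exact thermalSimplex_subset_four hsum (hanti (by decide)) (hanti (by decide))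
          (hanti (by decide)) (thermalVector_pos E β 3).le
    have hreach : ∀ v ∈ marginalPolytope (thermalVector E β),
        ∃ U : Matrix (Fin d × Fin d) (Fin d × Fin d) ℂ, IsLCSBlockDiagonal V U ∧
          HasSymmetricMarginals H β U (V * Matrix.diagonal (fun i => (v i : ℂ)) * Vᴴ) := by
      rcases hd with rfl | rfl
      exacts [fun v hv => exists_hasSymmetricMarginals_three hV hHV β hv,
        fun v hv => exists_hasSymmetricMarginals_four hV hHV β hv]
    refine ⟨hsub, hreach, fun β' h0 h => ?_⟩
    have hmem := newCoords_thermalVector_mem_thermalSimplex hE h0 h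
    have hpoly : thermalVector E β' ∈ marginalPolytope (thermalVector E β) :=
      hinj.mem_set_image.1 (hsub hmem)
    refine ⟨hmem, hpoly, ?_⟩
    rw [show IsSTU H β β' = fun U => HasSymmetricMarginals H β U
      (V * Matrix.diagonal (fun i => (thermalVector E β' i : ℂ)) * Vᴴ) by
        funext U; rw [IsSTU, gibbsState_eq_conj hV hHV]]
    exact hreach _ hpoly
  · intro hA β' h0 h
    obtain ⟨V, hV, E, hE, hHV⟩ := hH.exists_eq_conj_diagonal_monotone
    obtain ⟨U, -, hU⟩ := ((hA V E hV hE hHV).2.2 β' h0 h).2.2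
    exact ⟨U, hU⟩
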